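/- Let $T>0$, let $m\ge 1$, let $\alpha_0>\alpha_1>\dots>\alpha_m\ge 0$ be real numbers, let $n_i$ be the nonnegative integer with $n_i-1<\alpha_i\le n_i$, and let $a_1,\dots,a_m\in C[0,T]$ be real-valued. For $\alpha>0$ let $I_{0+}^{\alpha}f(t)=\frac1{\Gamma(\alpha)}\int_0^t(t-\tau)^{\alpha-1}f(\tau)\,d\tau$, let $I_{0+}^0f=f$, and for $n-1<\alpha\le n$ let $$D_{0+}^{\alpha}f=\frac{d^n}{dt^n}I_{0+}^{n-\alpha}f,\qquad {}^cD_{0+}^{\alpha}f=D_{0+}^{\alpha}\Big[f-\sum_{k=0}^{n-1}\frac{f^{(k)}(0)}{k!}t^k\Big].$$ Let $C^{\alpha_0,n_0-1}[0,T]$ be the space of all $y\in C^{n_0-1}[0,T]$ with ${}^cD_{0+}^{\alpha_0}y\in C[0,T]$, with the norm $\sum_{k=0}^{n_0-1}\max|y^{(k)}|+\max|{}^cD_{0+}^{\alpha_0}y|$. Consider the initial value problem $${}^cD_{0+}^{\alpha_0}y(t)=-\sum_{i=1}^m a_i(t)\,{}^cD_{0+}^{\alpha_i}y(t),\quad 0<t<T,\qquad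 (1)$$ $$y^{(k)}(+0)=b_k\in\mathbb R,\quad k=0,1,\dots,n_0-1.\qquad (2)$$ Put $H_j=\{i:0\le\alpha_i\le j,\ i=1,\dots,m\}$ and, if $H_j\ne\emptyset$, $h_j=\min H_j$. Put $\Phi_{j+1}(t)=t^j/j!$ and $\Phi_{j+1-\alpha_i}=D_{0+}^{\alpha_i}\Phi_{j+1}$. Assume that $n_0>n_1$, that $n_0\ge2$, and that there is $j_0\in\{0,\dots,n_0-2\}$ with $H_{j_0}=\emptyset$ and $H_{j_0+1}\neq\emptyset$. Then there are $y_j\in C^{\alpha_0,n_0-1}[0,T]$, $j=0,\dots,n_0-1$, forming the canonical fundamental system of (1) (that is, $y_j$ solves (1) with $y_j^{(k)}(+0)=\delta_{jk}$ for $k=0,\dots,n_0-1$), given on $[0,T]$ by $$y_j=\Phi_{j+1},\qquad j=0,\dots,j_0,$$ $$y_j=\Phi_{j+1}+\sum_{k=0}^{\infty}(-1)^{k+1}I_{0+}^{\alpha_0}\Big[\sum_{i=1}^m a_iI_{0+}^{\alpha_0-\alpha_i}\Big]^k\sum_{i=h_j}^m a_i\Phi_{j+1-\alpha_i},\qquad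 j=j_0+1,\dots,n_1-1,$$ $$y_j=\Phi_{j+1}+\sum_{k=0}^{\infty}(-1)^{k+1}I_{0+}^{\alpha_0}\Big[\sum_{i=1}^m a_iI_{0+}^{\alpha_0-\alpha_i}\Big]^k\sum_{i=1}^m a_i\Phi_{j+1-\alpha_i},\qquad j=n_1,\dots,n_0-1,$$ where the series converge in $C^{\alpha_0,n_0-1}[0,T]$; and for all $b_0,\dots,b_{n_0-1}\in\mathbb R$ the problem (1)-(2) has exactly one solution $y\in C^{\alpha_0,n_0-1}[0,T]$, namely $y=\sum_{j=0}^{n_0-1}b_jy_j$. -/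

import Mathlib

open Set Filter Topology

noncomputable section

namespace FracODE

/-- Riemann-Liouville fractional integral `I_{0+}^α f (t)`, with `I^0 f = f`. -/
def rlIntegral (α : ℝ) (f : ℝ → ℝ) (t : ℝ) : ℝ :=
  if α = 0 then f t
  else (Real.Gamma α)⁻¹ * ∫ τ in (0 : ℝ)..t, (t - τ) ^ (α - 1) * f τ

/-- Riemann-Liouville derivative `D_{0+}^α f (t) = (d/dt)^n I_{0+}^{n-α} f (t)` of a function on
`[0, T]`, for `0 < t ≤ T`, where `n - 1 < α ≤ n` (derivatives at `T` are one-sided). -/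
def rlDeriv (T α : ℝ) (f : ℝ → ℝ) (t : ℝ) : ℝ :=
  iteratedDerivWithin ⌈α⌉₊ (rlIntegral (⌈α⌉₊ - α) f) (Ioc 0 T) t

/-- The derivative `D_{0+}^α f` exists on `(0, T]`: the function `I_{0+}^{n-α} f` is `n` times
differentiable there. -/
def RLDifferentiable (T α : ℝ) (f : ℝ → ℝ) : Prop :=
  ∀ k < ⌈α⌉₊, DifferentiableOn ℝ
    (iteratedDerivWithin k (rlIntegral (⌈α⌉₊ - α) f) (Ioc 0 T)) (Ioc 0 T)

/-- `f - ∑_{k < n} f^{(k)}(0) t^k / k!`, for a function `f` on `[0, T]`. -/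
def taylorRemainder (T : ℝ) (n : ℕ) (f : ℝ → ℝ) (t : ℝ) : ℝ :=
  f t - ∑ k ∈ Finset.range n, iteratedDerivWithin k f (Icc 0 T) 0 / (k.factorial : ℝ) * t ^ k

/-- Caputo derivative `ᶜD_{0+}^α f (t)`, for `0 < t ≤ T`. -/
def caputo (T α : ℝ) (f : ℝ → ℝ) (t : ℝ) : ℝ :=
  rlDeriv T α (taylorRemainder T ⌈α⌉₊ f) t

/-- The Caputo derivative `ᶜD_{0+}^α f` exists on `(0, T]`: the values `f^{(k)}(0)`, `k < n`,
exist and the Riemann-Liouville derivative of the remainder exists. -/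
def CaputoDifferentiable (T α : ℝ) (f : ℝ → ℝ) : Prop :=
  (∀ k, k + 1 < ⌈α⌉₊ →
    DifferentiableWithinAt ℝ (iteratedDerivWithin k f (Icc 0 T)) (Icc 0 T) 0) ∧
  RLDifferentiable T α (taylorRemainder T ⌈α⌉₊ f)

/-- The space `C^{α, r}[0, T]` of the functions `y ∈ C^r[0, T]` whose Caputo derivative of order
`α` exists and belongs to `C[0, T]`. -/
def MemC (T α : ℝ) (r : ℕ) (y : ℝ → ℝ) : Prop :=
  ContDiffOn ℝ r y (Icc 0 T) ∧ CaputoDifferentiable T α y ∧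
    ∃ v : ℝ → ℝ, ContinuousOn v (Icc 0 T) ∧ EqOn (caputo T α y) v (Ioc 0 T)

/-- Convergence `u N → y` in the space `C^{α, r}[0, T]`, whose norm is
`∑_{k ≤ r} max |y^{(k)}| + max |ᶜD_{0+}^α y|`. -/
def TendstoC (T α : ℝ) (r : ℕ) (u : ℕ → ℝ → ℝ) (y : ℝ → ℝ) : Prop :=
  (∀ N, MemC T α r (u N)) ∧ MemC T α r y ∧
  (∀ k ≤ r, TendstoUniformlyOn (fun N => iteratedDerivWithin k (u N) (Icc 0 T))
    (iteratedDerivWithin k y (Icc 0 T)) atTop (Icc 0 T)) ∧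
  TendstoUniformlyOn (fun N => caputo T α (u N)) (caputo T α y) atTop (Ioc 0 T)

/-- `y ∈ C^{α₀, n₀-1}[0, T]` solves
`ᶜD^{α₀} y (t) = - ∑_{i=1}^m a_i(t) ᶜD^{α_i} y (t)` for `0 < t < T`, with
`y^{(k)}(0+) = b_k` for `k = 0, …, n₀ - 1`, where `n₀ = ⌈α₀⌉`. -/
structure IsSolution (T : ℝ) (m : ℕ) (α : ℕ → ℝ) (a : ℕ → ℝ → ℝ) (b : ℕ → ℝ)
    (y : ℝ → ℝ) : Prop where
  mem : MemC T (α 0) (⌈α 0⌉₊ - 1) y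
  exists_deriv : ∀ i ∈ Finset.Icc 1 m, CaputoDifferentiable T (α i) y
  equation : ∀ t ∈ Ioo 0 T,
    caputo T (α 0) y t = - ∑ i ∈ Finset.Icc 1 m, a i t * caputo T (α i) y t
  initial : ∀ k < ⌈α 0⌉₊,
    Tendsto (iteratedDerivWithin k y (Icc 0 T)) (𝓝[>] 0) (𝓝 (b k))

/-- A canonical fundamental system in `C^{α₀, n₀-1}[0, T]`: `y_j` solves the equation with
`y_j^{(k)}(0+) = δ_{jk}`. -/
def IsCanonicalSystem (T : ℝ) (m : ℕ) (α : ℕ → ℝ) (a : ℕ → ℝ → ℝ) (y : ℕ → ℝ → ℝ) : Prop :=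
  ∀ j < ⌈α 0⌉₊, IsSolution T m α a (fun k => if k = j then 1 else 0) (y j)

/-- `H_j = {i : 0 ≤ α_i ≤ j, i = 1, …, m}`. -/
def indexSet (m : ℕ) (α : ℕ → ℝ) (j : ℕ) : Set ℕ :=
  {i | 1 ≤ i ∧ i ≤ m ∧ 0 ≤ α i ∧ α i ≤ j}

/-- `h_j = min H_j` (used only when `H_j` is non-empty). -/
def minIndex (m : ℕ) (α : ℕ → ℝ) (j : ℕ) : ℕ := sInf (indexSet m α j)

/-- `Φ_{j+1}(t) = t^j / j!`. -/
def Phi (j : ℕ) (t : ℝ) : ℝ := t ^ j / (j.factorial : ℝ)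

/-- `Φ_{j+1-α} = D_{0+}^α Φ_{j+1}`. -/
def PhiFrac (T : ℝ) (j : ℕ) (α : ℝ) : ℝ → ℝ := rlDeriv T α (Phi j)

/-- The operator `∑_{i=1}^m a_i(t) I_{0+}^{α₀-α_i}`. -/
def stepOp (m : ℕ) (α : ℕ → ℝ) (a : ℕ → ℝ → ℝ) (f : ℝ → ℝ) (t : ℝ) : ℝ :=
  ∑ i ∈ Finset.Icc 1 m, a i t * rlIntegral (α 0 - α i) f t

/-- The partial sum
`Φ_{j+1} + ∑_{k < N} (-1)^{k+1} I^{α₀} [∑_{i=1}^m a_i I^{α₀-α_i}]^k ∑_{i=l}^m a_i Φ_{j+1-α_i}`. -/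
def partialSum (T : ℝ) (m : ℕ) (α : ℕ → ℝ) (a : ℕ → ℝ → ℝ) (j l N : ℕ) (t : ℝ) : ℝ :=
  Phi j t + ∑ k ∈ Finset.range N, (-1 : ℝ) ^ (k + 1) *
    rlIntegral (α 0)
      ((stepOp m α a)^[k] (fun s => ∑ i ∈ Finset.Icc l m, a i s * PhiFrac T j (α i) s)) t

end FracODE

end

open Set Filter Topology

noncomputable section

namespace FracODE

open MeasureTheory

/-! A function belongs to $C^{\alpha_0,n_0-1}[0,T]$ exactly when it is $\sum_j
b_j\Phi_{j+1}+I^{\alpha_0}v$ with $v$ continuous; then $v$ is its Caputo derivative of order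
$\alpha_0$ and the $b_j$ are its initial data. One direction is `memC_of_expansion`, the other
`exists_expansion_of_memC`; both rest on the semigroup law `rlIntegral_rlIntegral`.

For such a function every lower Caputo derivative is explicit (`caputo_of_expansion`), so the
initial value problem is equivalent to $v=-\sum_j b_jg_j-Kv$, where $K=\sum_i
a_iI^{\alpha_0-\alpha_i}$ and $g_j=\sum_{\alpha_i\le j}a_i\Phi_{j+1-\alpha_i}$.

All orders $\alpha_0-\alpha_i$ are positive, and $I^\beta$ has norm at most $\lambda^{-\beta}$ for
the weight $e^{\lambda t}$ (`abs_rlIntegral_le`). For large $\lambda$ the operator $K$ therefore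
halves the weighted norm: the Neumann series gives existence (`exists_neumann_limit`), and iterating
the bound on a difference gives uniqueness (`eqOn_of_fixedPoint`). Applying $I^{\alpha_0}$ to the
series yields the stated formulas.

The three ranges of $j$ differ only in $\{i:\alpha_i\le j\}$: it is empty, a final segment starting
at $h_j$, or all of $1,\dots,m$. -/

/-! ### Elementary properties of the fractional integral -/

lemma rlIntegral_zero_order (f : ℝ → ℝ) (t : ℝ) : rlIntegral 0 f t = f t := by
  simp [rlIntegral]

lemma rlIntegral_of_pos {α : ℝ} (hα : 0 < α) (f : ℝ → ℝ) (t : ℝ) :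
    rlIntegral α f t = (Real.Gamma α)⁻¹ * ∫ τ in (0 : ℝ)..t, (t - τ) ^ (α - 1) * f τ := by
  simp [rlIntegral, hα.ne']

lemma rlIntegral_apply_zero {α : ℝ} (hα : 0 < α) (f : ℝ → ℝ) : rlIntegral α f 0 = 0 := by
  simp [rlIntegral_of_pos hα]

lemma rlIntegral_one (f : ℝ → ℝ) (t : ℝ) : rlIntegral 1 f t = ∫ τ in (0 : ℝ)..t, f τ := by
  simp [rlIntegral_of_pos one_pos]

lemma rlIntegral_congr_of_pos {α t : ℝ} (hα : 0 < α) (ht : 0 ≤ t) {f g : ℝ → ℝ}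
    (h : EqOn f g (Ioc 0 t)) : rlIntegral α f t = rlIntegral α g t := by
  rw [rlIntegral_of_pos hα, rlIntegral_of_pos hα]
  congr 1
  refine intervalIntegral.integral_congr_ae (Eventually.of_forall fun x hx => ?_)
  rw [uIoc_of_le ht] at hx
  simp only [h hx]

lemma rlIntegral_congr_Ioc {T α : ℝ} {f g : ℝ → ℝ} (hα : 0 ≤ α) (h : EqOn f g (Ioc 0 T)) :
    EqOn (rlIntegral α f) (rlIntegral α g) (Ioc 0 T) := by
  intro t ht
  rcases hα.eq_or_lt with rfl | hα
  · simpa [rlIntegral_zero_order] using h ht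
  · exact rlIntegral_congr_of_pos hα ht.1.le (h.mono (Ioc_subset_Ioc_right ht.2))

lemma rlIntegral_congr_Icc {T α : ℝ} {f g : ℝ → ℝ} (hα : 0 ≤ α) (h : EqOn f g (Icc 0 T)) :
    EqOn (rlIntegral α f) (rlIntegral α g) (Icc 0 T) := by
  intro t ht
  rcases hα.eq_or_lt with rfl | hα
  · simpa [rlIntegral_zero_order] using h ht
  · exact rlIntegral_congr_of_pos hα ht.1 fun x hx => h ⟨hx.1.le, hx.2.trans ht.2⟩

lemma intervalIntegrable_rlKernel {α a b t : ℝ} (hα : 0 < α) :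
    IntervalIntegrable (fun τ => (t - τ) ^ (α - 1)) volume a b := by
  have := (intervalIntegral.intervalIntegrable_rpow' (a := t - a) (b := t - b)
    (r := α - 1) (by linarith)).comp_sub_left t
  simpa using this

lemma intervalIntegrable_rlKernel_mul {T α t : ℝ} (hα : 0 < α) (ht : t ∈ Icc 0 T) {f : ℝ → ℝ}
    (hf : ContinuousOn f (Icc 0 T)) :
    IntervalIntegrable (fun τ => (t - τ) ^ (α - 1) * f τ) volume 0 t := by
  refine (intervalIntegrable_rlKernel hα).mul_continuousOn (hf.mono ?_)
  rw [uIcc_of_le ht.1]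
  exact Icc_subset_Icc_right ht.2

lemma rlIntegral_add {T α t : ℝ} (hα : 0 ≤ α) (ht : t ∈ Icc 0 T) {f g : ℝ → ℝ}
    (hf : ContinuousOn f (Icc 0 T)) (hg : ContinuousOn g (Icc 0 T)) :
    rlIntegral α (fun s => f s + g s) t = rlIntegral α f t + rlIntegral α g t := by
  rcases hα.eq_or_lt with rfl | hα
  · simp [rlIntegral_zero_order]
  · simp only [rlIntegral_of_pos hα, mul_add]
    rw [intervalIntegral.integral_add (intervalIntegrable_rlKernel_mul hα ht hf)
      (intervalIntegrable_rlKernel_mul hα ht hg), mul_add]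

lemma rlIntegral_const_mul (α c : ℝ) (f : ℝ → ℝ) (t : ℝ) :
    rlIntegral α (fun s => c * f s) t = c * rlIntegral α f t := by
  unfold rlIntegral
  split_ifs
  · rfl
  · simp only [mul_left_comm _ c, intervalIntegral.integral_const_mul]

lemma rlIntegral_zero_fun (α : ℝ) (t : ℝ) : rlIntegral α (fun _ => 0) t = 0 := by
  simp [rlIntegral]

lemma rlIntegral_sum {T α t : ℝ} (hα : 0 ≤ α) (ht : t ∈ Icc 0 T) {ι : Type*} (s : Finset ι)
    {f : ι → ℝ → ℝ} (hf : ∀ i ∈ s, ContinuousOn (f i) (Icc 0 T)) :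
    rlIntegral α (fun x => ∑ i ∈ s, f i x) t = ∑ i ∈ s, rlIntegral α (f i) t := by
  classical
  induction s using Finset.induction_on with
  | empty => simp [rlIntegral_zero_fun]
  | insert i s hi ih =>
    simp only [Finset.sum_insert hi]
    rw [rlIntegral_add hα ht (hf i (by simp))
      (continuousOn_finsetSum _ fun j hj => hf j (by simp [hj])),
      ih fun j hj => hf j (by simp [hj])]

lemma rlIntegral_sub {T α t : ℝ} (hα : 0 ≤ α) (ht : t ∈ Icc 0 T) {f g : ℝ → ℝ}
    (hf : ContinuousOn f (Icc 0 T)) (hg : ContinuousOn g (Icc 0 T)) :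
    rlIntegral α (fun s => f s - g s) t = rlIntegral α f t - rlIntegral α g t := by
  have h := rlIntegral_add hα ht hf (g := fun s => -1 * g s) (continuousOn_const.mul hg)
  rw [rlIntegral_const_mul] at h
  simpa [sub_eq_add_neg] using h

/-- The change of variables `τ = t x` in the fractional integral. -/
lemma rlIntegral_eq_integral_unit {α t : ℝ} (hα : 0 < α) (ht : 0 ≤ t) (f : ℝ → ℝ) :
    rlIntegral α f t =
      (Real.Gamma α)⁻¹ * (t ^ α * ∫ x in (0 : ℝ)..1, (1 - x) ^ (α - 1) * f (t * x)) := by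
  rcases ht.eq_or_lt with rfl | ht
  · simp [rlIntegral_of_pos hα, Real.zero_rpow hα.ne']
  rw [rlIntegral_of_pos hα]
  congr 1
  have h := intervalIntegral.smul_integral_comp_mul_left (a := 0) (b := 1)
    (fun τ => (t - τ) ^ (α - 1) * f τ) t
  simp only [mul_zero, mul_one, smul_eq_mul] at h
  rw [← h, ← intervalIntegral.integral_const_mul, ← intervalIntegral.integral_const_mul]
  refine intervalIntegral.integral_congr fun x hx => ?_
  rw [uIcc_of_le zero_le_one] at hx
  have h1 : (t - t * x) ^ (α - 1) = t ^ (α - 1) * (1 - x) ^ (α - 1) := by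
    rw [← Real.mul_rpow ht.le (by linarith [hx.2])]
    ring_nf
  have h2 : t ^ α = t * t ^ (α - 1) := by
    rw [← Real.rpow_one_add' ht.le (by linarith), add_sub_cancel]
  simp only [h1, h2]
  ring

/-- After the substitution $\tau=tx$ the domain of integration no longer depends on $t$, and
dominated convergence applies with majorant $M(1-x)^{\alpha-1}$. -/
lemma continuousOn_rlIntegral {T α : ℝ} (hα : 0 ≤ α) {f : ℝ → ℝ}
    (hf : ContinuousOn f (Icc 0 T)) : ContinuousOn (rlIntegral α f) (Icc 0 T) := by
  rcases hα.eq_or_lt with rfl | hα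
  · exact hf.congr fun t _ => rlIntegral_zero_order f t
  obtain ⟨M, hM⟩ := isCompact_Icc.exists_bound_of_continuousOn hf
  have hmem : ∀ t ∈ Icc (0 : ℝ) T, ∀ x ∈ Icc (0 : ℝ) 1, t * x ∈ Icc (0 : ℝ) T := fun t ht x hx =>
    ⟨mul_nonneg ht.1 hx.1, (mul_le_of_le_one_right ht.1 hx.2).trans ht.2⟩
  refine ContinuousOn.congr (f := fun t => (Real.Gamma α)⁻¹ *
    (t ^ α * ∫ x in (0 : ℝ)..1, (1 - x) ^ (α - 1) * f (t * x))) ?_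
    fun t ht => rlIntegral_eq_integral_unit hα ht.1 f
  refine continuousOn_const.mul
    ((Real.continuous_rpow_const hα.le).continuousOn.mul fun t ht => ?_)
  refine intervalIntegral.continuousWithinAt_of_dominated_interval
    (bound := fun x => (1 - x) ^ (α - 1) * M) ?_ ?_
    ((intervalIntegrable_rlKernel hα).mul_const M) ?_
  · filter_upwards [self_mem_nhdsWithin] with s hs
    have hk : Measurable fun x : ℝ => (1 - x) ^ (α - 1) := by fun_prop
    refine hk.aestronglyMeasurable.mul ?_
    refine ContinuousOn.aestronglyMeasurable ?_ measurableSet_uIoc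
    refine hf.comp (by fun_prop) fun x hx => hmem s hs x ?_
    rw [uIoc_of_le zero_le_one] at hx
    exact Ioc_subset_Icc_self hx
  · filter_upwards [self_mem_nhdsWithin] with s hs
    refine Eventually.of_forall fun x hx => ?_
    rw [uIoc_of_le zero_le_one] at hx
    have h0 : (0 : ℝ) ≤ (1 - x) ^ (α - 1) := Real.rpow_nonneg (by linarith [hx.2]) _
    rw [norm_mul, Real.norm_of_nonneg h0]
    exact mul_le_mul_of_nonneg_left (hM _ (hmem s hs x (Ioc_subset_Icc_self hx))) h0
  · refine Eventually.of_forall fun x hx => ?_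
    rw [uIoc_of_le zero_le_one] at hx
    refine continuousWithinAt_const.mul ?_
    exact (hf _ (hmem t ht x (Ioc_subset_Icc_self hx))).comp (f := fun s => s * x)
      (by fun_prop) fun s hs => hmem s hs x (Ioc_subset_Icc_self hx)

/-! ### Beta integrals and the semigroup law -/

lemma integral_rpow_mul_sub_rpow {α β a : ℝ} (hα : 0 < α) (hβ : 0 < β) (ha : 0 < a) :
    ∫ x in (0 : ℝ)..a, x ^ (α - 1) * (a - x) ^ (β - 1) =
      a ^ (α + β - 1) * (Real.Gamma α * Real.Gamma β / Real.Gamma (α + β)) := by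
  have h := Complex.betaIntegral_scaled α β ha
  rw [Complex.betaIntegral_eq_Gamma_mul_div _ _ (by simpa) (by simpa), ← Complex.ofReal_add,
    Complex.Gamma_ofReal, Complex.Gamma_ofReal, Complex.Gamma_ofReal] at h
  have h2 : (∫ x in (0 : ℝ)..a, (x : ℂ) ^ ((α : ℂ) - 1) * ((a : ℂ) - x) ^ ((β : ℂ) - 1)) =
      ((∫ x in (0 : ℝ)..a, x ^ (α - 1) * (a - x) ^ (β - 1) : ℝ) : ℂ) := by
    rw [← intervalIntegral.integral_ofReal]
    refine intervalIntegral.integral_congr fun x hx => ?_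
    rw [uIcc_of_le ha.le] at hx
    simp only [Complex.ofReal_mul]
    rw [Complex.ofReal_cpow hx.1, Complex.ofReal_cpow (by linarith [hx.2])]
    push_cast
    rfl
  rw [h2] at h
  have h3 : ((a : ℂ)) ^ (((α + β : ℝ) : ℂ) - 1) = ((a ^ (α + β - 1) : ℝ) : ℂ) := by
    rw [Complex.ofReal_cpow ha.le]
    push_cast
    rfl
  rw [h3] at h
  exact_mod_cast h

lemma integral_rlKernel_comp {α β τ t : ℝ} (hα : 0 < α) (hβ : 0 < β) (h : τ < t) :
    ∫ s in τ..t, (t - s) ^ (α - 1) * (s - τ) ^ (β - 1) =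
      (t - τ) ^ (α + β - 1) * (Real.Gamma α * Real.Gamma β / Real.Gamma (α + β)) := by
  have h1 := intervalIntegral.integral_comp_sub_right (a := τ) (b := t)
    (fun x => x ^ (β - 1) * ((t - τ) - x) ^ (α - 1)) τ
  rw [sub_self, integral_rpow_mul_sub_rpow hβ hα (sub_pos.2 h)] at h1
  rw [add_comm α β, mul_comm (Real.Gamma α), ← h1]
  refine intervalIntegral.integral_congr fun s _ => ?_
  simp only [sub_sub_sub_cancel_right]
  ring

lemma integral_rlKernel {β s : ℝ} (hβ : 0 < β) :
    ∫ τ in (0 : ℝ)..s, (s - τ) ^ (β - 1) = s ^ β / β := by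
  have h := intervalIntegral.integral_comp_sub_left (a := 0) (b := s)
    (fun x => x ^ (β - 1)) s
  rw [h, sub_self, sub_zero, integral_rpow (Or.inl (by linarith))]
  simp [Real.zero_rpow hβ.ne']

/-- Fubini on the triangle $0<\tau<s<t$: the inner integral in $s$ is a Beta integral whose Gamma
factors cancel the normalisations. Continuity on the whole line makes the joint integrand
measurable. -/
lemma rlIntegral_rlIntegral_of_continuous {α β t : ℝ} (hα : 0 < α) (hβ : 0 < β) (ht : 0 < t) {f : ℝ → ℝ}
    (hf : Continuous f) :
    rlIntegral α (rlIntegral β f) t = rlIntegral (α + β) f t := by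
  obtain ⟨M, hM⟩ := isCompact_Icc.exists_bound_of_continuousOn (hf.continuousOn (s := Icc 0 t))
  set μ := volume.restrict (Ioc (0 : ℝ) t) with hμ
  -- Extension by zero off the triangle turns the iterated integrals into integrals over the square
  -- $(0,t]^2$.
  set F : ℝ → ℝ → ℝ := fun s τ =>
    if τ < s then (t - s) ^ (α - 1) * ((s - τ) ^ (β - 1) * f τ) else 0 with hF
  have hmeas : Measurable (Function.uncurry F) := by
    refine Measurable.ite (measurableSet_lt measurable_snd measurable_fst) ?_ measurable_const
    have := hf.measurable
    fun_prop
  have hslice : ∀ s, F s = (Iio s).indicator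
      (fun τ => (t - s) ^ (α - 1) * ((s - τ) ^ (β - 1) * f τ)) := fun s => by
    ext τ
    simp [hF, indicator_apply]
  have hslice' : ∀ τ, (fun s => F s τ) = (Ioi τ).indicator
      (fun s => (t - s) ^ (α - 1) * ((s - τ) ^ (β - 1) * f τ)) := fun τ => by
    ext s
    simp [hF, indicator_apply]
  have hset : ∀ s ∈ Ioc 0 t, Ioc 0 t ∩ Iio s = Ioo 0 s := fun s hs => by
    ext x
    simp only [mem_inter_iff, mem_Ioc, mem_Iio, mem_Ioo]
    exact ⟨fun h => ⟨h.1.1, h.2⟩, fun h => ⟨⟨h.1, h.2.le.trans hs.2⟩, h.2⟩⟩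
  have hset' : ∀ τ ∈ Ioc 0 t, Ioc 0 t ∩ Ioi τ = Ioc τ t := fun τ hτ => by
    ext x
    simp only [mem_inter_iff, mem_Ioc, mem_Ioi]
    exact ⟨fun h => ⟨h.2, h.1.2⟩, fun h => ⟨⟨hτ.1.trans h.1, h.2⟩, h.1⟩⟩
  have hinner : ∀ s ∈ Ioc 0 t, ∫ τ, F s τ ∂μ =
      (t - s) ^ (α - 1) * ∫ τ in (0 : ℝ)..s, (s - τ) ^ (β - 1) * f τ := fun s hs => by
    rw [hslice, setIntegral_indicator measurableSet_Iio, hset s hs, ← integral_Ioc_eq_integral_Ioo,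
      integral_const_mul, intervalIntegral.integral_of_le hs.1.le]
  have hint : Integrable (Function.uncurry F) (μ.prod μ) := by
    rw [integrable_prod_iff hmeas.aestronglyMeasurable]
    have hker : ∀ s ∈ Ioc 0 t, IntegrableOn (fun τ => (s - τ) ^ (β - 1) * f τ) (Ioo 0 s) := by
      intro s hs
      have h := intervalIntegrable_rlKernel_mul hβ (T := t) ⟨hs.1.le, hs.2⟩ hf.continuousOn
      rw [intervalIntegrable_iff_integrableOn_Ioc_of_le hs.1.le] at h
      exact h.mono_set Ioo_subset_Ioc_self
    constructor
    · refine (ae_restrict_iff' measurableSet_Ioc).2 (Eventually.of_forall fun s hs => ?_)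
      simp only [Function.uncurry_apply_pair]
      change Integrable (F s) μ
      rw [hslice, integrable_indicator_iff measurableSet_Iio, IntegrableOn, hμ,
        Measure.restrict_restrict measurableSet_Iio, inter_comm, hset s hs]
      exact (hker s hs).const_mul _
    · have hdom : Integrable (fun s => (t - s) ^ (α - 1) * (M * (t ^ β / β))) μ := by
        have h := (intervalIntegrable_rlKernel (a := 0) (b := t) (t := t) hα).mul_const
          (M * (t ^ β / β))
        rwa [intervalIntegrable_iff_integrableOn_Ioc_of_le ht.le] at h
      refine hdom.mono' (hmeas.norm.aestronglyMeasurable.integral_prod_right') ?_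
      refine (ae_restrict_iff' measurableSet_Ioc).2 (Eventually.of_forall fun s hs => ?_)
      rw [Real.norm_of_nonneg (integral_nonneg fun _ => norm_nonneg _)]
      have h0 : 0 ≤ (t - s) ^ (α - 1) := Real.rpow_nonneg (by linarith [hs.2]) _
      have hM0 : 0 ≤ M := (norm_nonneg _).trans (hM 0 ⟨le_rfl, ht.le⟩)
      have hn : ∀ τ, ‖F s τ‖ = (Iio s).indicator
          (fun τ => (t - s) ^ (α - 1) * ‖(s - τ) ^ (β - 1) * f τ‖) τ := fun τ => by
        rw [hslice]
        by_cases h : τ ∈ Iio s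
        · rw [indicator_of_mem h, indicator_of_mem h, norm_mul, Real.norm_of_nonneg h0]
        · rw [indicator_of_notMem h, indicator_of_notMem h, norm_zero]
      simp only [Function.uncurry_apply_pair, hn]
      rw [setIntegral_indicator measurableSet_Iio, hset s hs, integral_const_mul]
      refine mul_le_mul_of_nonneg_left ?_ h0
      have hk := intervalIntegrable_rlKernel (a := 0) (b := s) (t := s) hβ
      rw [intervalIntegrable_iff_integrableOn_Ioc_of_le hs.1.le] at hk
      calc ∫ τ in Ioo 0 s, ‖(s - τ) ^ (β - 1) * f τ‖
          ≤ ∫ τ in Ioo 0 s, M * (s - τ) ^ (β - 1) := by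
            refine setIntegral_mono_on (hker s hs).norm
              ((hk.mono_set Ioo_subset_Ioc_self).const_mul M) measurableSet_Ioo fun τ hτ => ?_
            have h1 : 0 ≤ (s - τ) ^ (β - 1) := Real.rpow_nonneg (by linarith [hτ.2]) _
            rw [norm_mul, Real.norm_of_nonneg h1, mul_comm]
            exact mul_le_mul_of_nonneg_right (hM τ ⟨hτ.1.le, hτ.2.le.trans hs.2⟩) h1
        _ = M * (s ^ β / β) := by
            rw [integral_const_mul, ← integral_Ioc_eq_integral_Ioo,
              ← intervalIntegral.integral_of_le hs.1.le, integral_rlKernel hβ]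
        _ ≤ M * (t ^ β / β) := by
            gcongr
            · exact hs.1.le
            · exact hs.2
  have hswap := integral_integral_swap hint
  have hL : ∫ s, ∫ τ, F s τ ∂μ ∂μ =
      ∫ s in (0 : ℝ)..t, (t - s) ^ (α - 1) * ∫ τ in (0 : ℝ)..s, (s - τ) ^ (β - 1) * f τ := by
    rw [intervalIntegral.integral_of_le ht.le]
    exact setIntegral_congr_fun measurableSet_Ioc hinner
  have hR : ∫ τ, ∫ s, F s τ ∂μ ∂μ = ∫ τ in (0 : ℝ)..t,
      (Real.Gamma α * Real.Gamma β / Real.Gamma (α + β)) * ((t - τ) ^ (α + β - 1) * f τ) := by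
    rw [intervalIntegral.integral_of_le ht.le, integral_Ioc_eq_integral_Ioo,
      integral_Ioc_eq_integral_Ioo]
    refine setIntegral_congr_fun measurableSet_Ioo fun τ hτ => ?_
    rw [hslice', setIntegral_indicator measurableSet_Ioi, hset' τ ⟨hτ.1, hτ.2.le⟩]
    simp only [← mul_assoc]
    rw [integral_mul_const, ← intervalIntegral.integral_of_le hτ.2.le,
      integral_rlKernel_comp hα hβ hτ.2]
    ring
  rw [hL, hR, intervalIntegral.integral_const_mul] at hswap
  have hΓα := (Real.Gamma_pos_of_pos hα).ne'
  have hΓβ := (Real.Gamma_pos_of_pos hβ).ne'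
  have hΓ := (Real.Gamma_pos_of_pos (add_pos hα hβ)).ne'
  rw [rlIntegral_of_pos hα, rlIntegral_of_pos (add_pos hα hβ)]
  simp only [rlIntegral_of_pos hβ, mul_left_comm _ (Real.Gamma β)⁻¹,
    intervalIntegral.integral_const_mul]
  rw [hswap]
  field_simp

/-- The semigroup law `I^α I^β = I^{α+β}` on `C[0, T]`. -/
lemma rlIntegral_rlIntegral {T α β : ℝ} (hα : 0 ≤ α) (hβ : 0 ≤ β) {f : ℝ → ℝ}
    (hf : ContinuousOn f (Icc 0 T)) :
    EqOn (rlIntegral α (rlIntegral β f)) (rlIntegral (α + β) f) (Icc 0 T) := by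
  intro t ht
  rcases hα.eq_or_lt with rfl | hα
  · simp [rlIntegral_zero_order]
  rcases hβ.eq_or_lt with rfl | hβ
  · rw [add_zero]
    congr 1
    ext s
    exact rlIntegral_zero_order f s
  rcases ht.1.eq_or_lt with rfl | ht0
  · rw [rlIntegral_apply_zero hα, rlIntegral_apply_zero (add_pos hα hβ)]
  have hT : 0 ≤ T := ht.1.trans ht.2
  -- The integrals only see values on $[0,T]$, so $f$ may be replaced by its continuous extension,
  -- constant on either side of the interval.
  have hF : Continuous (IccExtend hT ((Icc 0 T).domRestrict f)) :=
    (continuousOn_iff_continuous_domRestrict.1 hf).Icc_extend'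
  have hE : EqOn f (IccExtend hT ((Icc 0 T).domRestrict f)) (Icc 0 T) := fun x hx => by
    rw [IccExtend_of_mem _ _ hx]
    rfl
  rw [rlIntegral_congr_Icc (add_pos hα hβ).le hE ht,
    rlIntegral_congr_Icc hα.le (rlIntegral_congr_Icc hβ.le hE) ht]
  exact rlIntegral_rlIntegral_of_continuous hα hβ ht0 hF

/-! ### Differentiation of fractional integrals and exponentially weighted bounds -/

/-- The semigroup law writes $I^\gamma f=I^1I^{\gamma-1}f$, and the fundamental theorem of calculus
applies because $I^{\gamma-1}f$ is continuous, also when $\gamma=1$. -/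
lemma hasDerivWithinAt_rlIntegral {T γ t : ℝ} (hγ : 1 ≤ γ) {f : ℝ → ℝ}
    (hf : ContinuousOn f (Icc 0 T)) (ht : t ∈ Icc 0 T) :
    HasDerivWithinAt (rlIntegral γ f) (rlIntegral (γ - 1) f t) (Icc 0 T) t := by
  have hc := continuousOn_rlIntegral (α := γ - 1) (by linarith) hf
  have hE : EqOn (rlIntegral γ f) (fun u => ∫ τ in (0 : ℝ)..u, rlIntegral (γ - 1) f τ)
      (Icc 0 T) := fun u hu => by
    change _ = ∫ τ in (0 : ℝ)..u, rlIntegral (γ - 1) f τ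
    rw [← rlIntegral_one, rlIntegral_rlIntegral zero_le_one (by linarith) hf hu,
      add_sub_cancel]
  refine HasDerivWithinAt.congr_of_mem ?_ hE ht
  have : Fact (t ∈ Icc 0 T) := ⟨ht⟩
  refine intervalIntegral.integral_hasDerivWithinAt_right ?_ ?_ (hc t ht)
  · refine (hc.mono ?_).intervalIntegrable
    rw [uIcc_of_le ht.1]
    exact Icc_subset_Icc_right ht.2
  · exact hc.stronglyMeasurableAtFilter_nhdsWithin measurableSet_Icc t

/-- Writing $e^{\lambda\tau}=e^{\lambda t}e^{-\lambda(t-\tau)}$ and enlarging the domain to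
$(0,\infty)$ leaves the Gamma integral $\Gamma(\beta)\lambda^{-\beta}$. The small factor
$\lambda^{-\beta}$ is the source of the contraction. -/
lemma abs_rlIntegral_le {β lam C t : ℝ} (hβ : 0 ≤ β) (hlam : 0 < lam) (ht : 0 < t)
    {f : ℝ → ℝ} (hf : ∀ s ∈ Ioc 0 t, |f s| ≤ C * Real.exp (lam * s)) :
    |rlIntegral β f t| ≤ C * (1 / lam) ^ β * Real.exp (lam * t) := by
  rcases hβ.eq_or_lt with rfl | hβ
  · simpa [rlIntegral_zero_order] using hf t ⟨ht, le_rfl⟩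
  have hC : 0 ≤ C := by
    have := (abs_nonneg _).trans (hf t ⟨ht, le_rfl⟩)
    exact nonneg_of_mul_nonneg_left this (Real.exp_pos _)
  have hΓ := Real.Gamma_pos_of_pos hβ
  rw [rlIntegral_of_pos hβ, abs_mul, abs_of_pos (inv_pos.2 hΓ), inv_mul_le_iff₀ hΓ]
  have hg := Real.integral_rpow_mul_exp_neg_mul_Ioi hβ hlam
  have hint : IntegrableOn (fun x : ℝ => x ^ (β - 1) * Real.exp (-(lam * x))) (Ioi 0) := by
    -- A non-integrable function has integral $0$ by convention, whereas the Gamma integral is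
    -- positive.
    by_contra h
    rw [integral_undef h] at hg
    have : 0 < (1 / lam) ^ β * Real.Gamma β := by positivity
    exact this.ne hg
  set G : ℝ → ℝ := fun x => C * Real.exp (lam * t) * (x ^ (β - 1) * Real.exp (-(lam * x))) with hG
  have hGint : IntervalIntegrable G volume 0 t := by
    rw [intervalIntegrable_iff_integrableOn_Ioc_of_le ht.le]
    exact (hint.mono_set Ioc_subset_Ioi_self).const_mul _
  calc |∫ τ in (0 : ℝ)..t, (t - τ) ^ (β - 1) * f τ|
      ≤ ∫ τ in (0 : ℝ)..t, G (t - τ) := by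
        rw [← Real.norm_eq_abs]
        refine intervalIntegral.norm_integral_le_of_norm_le ht.le
          (Eventually.of_forall fun τ hτ => ?_) (by simpa using (hGint.comp_sub_left t).symm)
        have h1 : 0 ≤ (t - τ) ^ (β - 1) := Real.rpow_nonneg (by linarith [hτ.2]) _
        rw [norm_mul, Real.norm_of_nonneg h1]
        refine (mul_le_mul_of_nonneg_left (hf τ hτ) h1).trans_eq ?_
        have : Real.exp (lam * τ) = Real.exp (lam * t) * Real.exp (-(lam * (t - τ))) := by
          rw [← Real.exp_add]
          ring_nf
        rw [hG, this]
        ring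
    _ = ∫ x in (0 : ℝ)..t, G x := by
        simp [intervalIntegral.integral_comp_sub_left (fun x => G x) t]
    _ = C * Real.exp (lam * t) * ∫ x in Ioc 0 t, x ^ (β - 1) * Real.exp (-(lam * x)) := by
        rw [intervalIntegral.integral_of_le ht.le, integral_const_mul]
    _ ≤ C * Real.exp (lam * t) * ((1 / lam) ^ β * Real.Gamma β) := by
        refine mul_le_mul_of_nonneg_left ?_ (by positivity)
        rw [← hg]
        refine setIntegral_mono_set hint ?_ Ioc_subset_Ioi_self.eventuallyLE
        refine (ae_restrict_iff' measurableSet_Ioi).2 (Eventually.of_forall fun x hx => ?_)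
        have : (0 : ℝ) < x := hx
        simp only [Pi.zero_apply]
        positivity
    _ = Real.Gamma β * (C * (1 / lam) ^ β * Real.exp (lam * t)) := by ring

/-! ### Towers of derivatives and inversion of the fractional integral -/

lemma iteratedDerivWithin_eq_of_chain {S : Set ℝ} (hS : UniqueDiffOn ℝ S) {n : ℕ} {y : ℝ → ℝ}
    {F : ℕ → ℝ → ℝ} (h0 : EqOn y (F 0) S)
    (hF : ∀ k < n, ∀ t ∈ S, HasDerivWithinAt (F k) (F (k + 1) t) S t) :
    ∀ k ≤ n, EqOn (iteratedDerivWithin k y S) (F k) S := by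
  intro k
  induction k with
  | zero => simpa [iteratedDerivWithin_zero] using h0
  | succ k ih =>
    intro hk t ht
    have hk' := ih (by omega)
    rw [iteratedDerivWithin_succ, derivWithin_congr hk' (hk' ht)]
    exact (hF k (by omega) t ht).derivWithin (hS t ht)

lemma contDiffOn_of_chain {S : Set ℝ} (hS : UniqueDiffOn ℝ S) {n : ℕ} {y : ℝ → ℝ}
    {F : ℕ → ℝ → ℝ} (h0 : EqOn y (F 0) S)
    (hF : ∀ k < n, ∀ t ∈ S, HasDerivWithinAt (F k) (F (k + 1) t) S t)
    (hc : ∀ k ≤ n, ContinuousOn (F k) S) : ContDiffOn ℝ n y S := by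
  have h := iteratedDerivWithin_eq_of_chain hS h0 hF
  refine contDiffOn_of_continuousOn_differentiableOn_deriv (n := (n : ℕ∞))
    (fun k hk => ?_) fun k hk => ?_
  · have hk : k ≤ n := by exact_mod_cast hk
    exact (hc k hk).congr (h k hk)
  · have hk : k < n := by exact_mod_cast hk
    exact DifferentiableOn.congr (fun t ht => (hF k hk t ht).differentiableWithinAt) (h k hk.le)

lemma hasDerivWithinAt_rlIntegral_chain {T γ : ℝ} {S : Set ℝ} (hS : S ⊆ Icc 0 T) {f : ℝ → ℝ}
    (hf : ContinuousOn f (Icc 0 T)) {k : ℕ} (hk : ((k + 1 : ℕ) : ℝ) ≤ γ) {t : ℝ} (ht : t ∈ S) :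
    HasDerivWithinAt (rlIntegral (γ - k) f) (rlIntegral (γ - (k + 1 : ℕ)) f t) S t := by
  push_cast at hk ⊢
  have h := hasDerivWithinAt_rlIntegral (γ := γ - k) (by linarith) hf (hS ht)
  rw [sub_sub] at h
  exact h.mono hS

/-- `D^α` inverts `I^α` on `C[0, T]`. -/
lemma rlDeriv_of_eqOn_rlIntegral {T α : ℝ} (hα : 0 ≤ α) {w F : ℝ → ℝ}
    (hF : ContinuousOn F (Icc 0 T)) (hw : EqOn w (rlIntegral α F) (Ioc 0 T)) :
    RLDifferentiable T α w ∧ EqOn (rlDeriv T α w) F (Ioc 0 T) := by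
  have hsub : Ioc 0 T ⊆ Icc 0 T := Ioc_subset_Icc_self
  have hn : α ≤ ⌈α⌉₊ := Nat.le_ceil α
  have h0 : EqOn (rlIntegral (⌈α⌉₊ - α) w)
      ((fun k : ℕ => rlIntegral ((⌈α⌉₊ : ℝ) - k) F) 0) (Ioc 0 T) := by
    -- $I^{n-\alpha}I^\alpha F=I^nF$, whose successive derivatives are $I^{n-k}F$, ending with $F$
    -- itself.
    intro t ht
    rw [rlIntegral_congr_Ioc (by linarith) hw ht,
      rlIntegral_rlIntegral (by linarith) hα hF (hsub ht)]
    simp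
  have hchain : ∀ k < ⌈α⌉₊, ∀ t ∈ Ioc 0 T, HasDerivWithinAt
      ((fun k : ℕ => rlIntegral ((⌈α⌉₊ : ℝ) - k) F) k)
      ((fun k : ℕ => rlIntegral ((⌈α⌉₊ : ℝ) - k) F) (k + 1) t) (Ioc 0 T) t :=
    fun k hk t ht => hasDerivWithinAt_rlIntegral_chain hsub hF (by exact_mod_cast hk) ht
  have h := iteratedDerivWithin_eq_of_chain (uniqueDiffOn_Ioc 0 T) h0 hchain
  constructor
  · exact fun k hk => DifferentiableOn.congr
      (fun t ht => (hchain k hk t ht).differentiableWithinAt) (h k hk.le)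
  · intro t ht
    rw [rlDeriv, h _ le_rfl ht]
    simp [rlIntegral_zero_order]

/-- Lets the semigroup law handle monomials, with no separate power rule for fractional integrals.
-/
lemma rlIntegral_natCast_one (j : ℕ) (t : ℝ) : rlIntegral j (fun _ => 1) t = Phi j t := by
  rcases j with _ | j
  · simp [rlIntegral_zero_order, Phi]
  · have hj : (0 : ℝ) < (j + 1 : ℕ) := by positivity
    rw [rlIntegral_of_pos hj]
    simp only [mul_one]
    rw [integral_rlKernel hj, Real.rpow_natCast, Phi, Nat.factorial_succ]
    push_cast
    rw [Real.Gamma_nat_eq_factorial]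
    field_simp

lemma phiFrac_eq {T α : ℝ} (hα : 0 ≤ α) {j : ℕ} (hj : α ≤ j) :
    EqOn (PhiFrac T j α) (rlIntegral (j - α) fun _ => 1) (Ioc 0 T) := by
  refine (rlDeriv_of_eqOn_rlIntegral hα
    (continuousOn_rlIntegral (by linarith) continuousOn_const) fun t ht => ?_).2
  rw [rlIntegral_rlIntegral hα (by linarith) continuousOn_const (Ioc_subset_Icc_self ht),
    add_sub_cancel, rlIntegral_natCast_one]

lemma hasDerivAt_phi_succ (j : ℕ) (t : ℝ) : HasDerivAt (Phi (j + 1)) (Phi j t) t := by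
  have h := (hasDerivAt_pow (j + 1) t).div_const ((j + 1).factorial : ℝ)
  have e : Phi j t = ((j + 1 : ℕ) : ℝ) * t ^ (j + 1 - 1) / ((j + 1).factorial : ℝ) := by
    rw [Phi, Nat.factorial_succ, add_tsub_cancel_right]
    push_cast
    field_simp
  rw [e]
  exact h

lemma continuous_phi (j : ℕ) : Continuous (Phi j) := by
  unfold Phi
  fun_prop

lemma phi_apply_zero (j : ℕ) : Phi j 0 = if j = 0 then 1 else 0 := by
  rcases j with _ | j <;> simp [Phi]

/-! ### Functions of the form Taylor polynomial plus $I^{\alpha_0}v$ -/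

/-- The function `∑_{j < n₀} b_j Φ_{j+1} + I^{α₀} v`, where `n₀ = ⌈α₀⌉`. -/
def expansion (α₀ : ℝ) (b : ℕ → ℝ) (v : ℝ → ℝ) (t : ℝ) : ℝ :=
  ∑ j ∈ Finset.range ⌈α₀⌉₊, b j * Phi j t + rlIntegral α₀ v t

/-- The `k`-th derivative of `expansion α₀ b v`. -/
def expansionDeriv (α₀ : ℝ) (b : ℕ → ℝ) (v : ℝ → ℝ) (k : ℕ) (t : ℝ) : ℝ :=
  ∑ j ∈ Finset.range (⌈α₀⌉₊ - k), b (j + k) * Phi j t + rlIntegral (α₀ - k) v t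

/-- The Caputo derivative of order `α` of `expansion α₀ b v`. -/
def expansionCaputo (α₀ : ℝ) (b : ℕ → ℝ) (v : ℝ → ℝ) (α t : ℝ) : ℝ :=
  ∑ j ∈ Finset.Ico ⌈α⌉₊ ⌈α₀⌉₊, b j * rlIntegral (j - α) (fun _ => 1) t + rlIntegral (α₀ - α) v t

section Expansion

variable {T α₀ : ℝ} {b : ℕ → ℝ} {v y : ℝ → ℝ}

lemma expansionDeriv_zero (α₀ : ℝ) (b : ℕ → ℝ) (v : ℝ → ℝ) :
    expansionDeriv α₀ b v 0 = expansion α₀ b v := by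
  ext t
  simp [expansionDeriv, expansion]

lemma continuousOn_expansionDeriv (hv : ContinuousOn v (Icc 0 T)) {k : ℕ} (hk : k < ⌈α₀⌉₊) :
    ContinuousOn (expansionDeriv α₀ b v k) (Icc 0 T) := by
  have hk' := Nat.lt_ceil.1 hk
  refine ContinuousOn.add (continuousOn_finsetSum _ fun j _ => ?_)
    (continuousOn_rlIntegral (by linarith) hv)
  exact continuousOn_const.mul (continuous_phi j).continuousOn

lemma hasDerivWithinAt_expansionDeriv (hv : ContinuousOn v (Icc 0 T)) {k : ℕ}
    (hk : k + 1 < ⌈α₀⌉₊) {t : ℝ} (ht : t ∈ Icc 0 T) :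
    HasDerivWithinAt (expansionDeriv α₀ b v k) (expansionDeriv α₀ b v (k + 1) t) (Icc 0 T) t := by
  have hk' := Nat.lt_ceil.1 hk
  refine HasDerivWithinAt.add ?_ (hasDerivWithinAt_rlIntegral_chain Subset.rfl hv hk'.le ht)
  obtain ⟨M, hM⟩ : ∃ M, ⌈α₀⌉₊ - k = M + 1 := ⟨⌈α₀⌉₊ - k - 1, by omega⟩
  have hM' : ⌈α₀⌉₊ - (k + 1) = M := by omega
  rw [hM, hM']
  -- The constant term $j=0$ is split off; it differentiates to zero, and the other terms shift down
  -- by one.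
  simp only [Finset.sum_range_succ' _ M]
  refine HasDerivAt.hasDerivWithinAt ?_
  have h0 : HasDerivAt (fun t => b (0 + k) * Phi 0 t) 0 t := by
    simpa [Phi] using hasDerivAt_const t (b k)
  have h := (HasDerivAt.fun_sum fun j (_ : j ∈ Finset.range M) =>
    (hasDerivAt_phi_succ j t).const_mul (b (j + 1 + k))).fun_add h0
  simpa [add_assoc, add_comm 1 k] using h

lemma expansionDeriv_apply_zero {k : ℕ} (hk : k < ⌈α₀⌉₊) : expansionDeriv α₀ b v k 0 = b k := by
  have hk' := Nat.lt_ceil.1 hk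
  have : 0 < ⌈α₀⌉₊ - k := by omega
  simp [expansionDeriv, rlIntegral_apply_zero (sub_pos.2 hk'), phi_apply_zero, this]

variable (hT : 0 < T) (hv : ContinuousOn v (Icc 0 T)) (hy : EqOn y (expansion α₀ b v) (Icc 0 T))
include hT hv hy

lemma iteratedDerivWithin_of_expansion {k : ℕ} (hk : k < ⌈α₀⌉₊) :
    EqOn (iteratedDerivWithin k y (Icc 0 T)) (expansionDeriv α₀ b v k) (Icc 0 T) :=
  iteratedDerivWithin_eq_of_chain (uniqueDiffOn_Icc hT) (n := ⌈α₀⌉₊ - 1)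
    (F := expansionDeriv α₀ b v) (by rwa [expansionDeriv_zero])
    (fun _ hj _ ht => hasDerivWithinAt_expansionDeriv hv (by omega) ht) k (by omega)

lemma contDiffOn_of_expansion (hα : 0 < α₀) : ContDiffOn ℝ (⌈α₀⌉₊ - 1 : ℕ) y (Icc 0 T) := by
  have := Nat.ceil_pos.2 hα
  exact contDiffOn_of_chain (uniqueDiffOn_Icc hT)
    (F := expansionDeriv α₀ b v) (by rwa [expansionDeriv_zero])
    (fun _ hj _ ht => hasDerivWithinAt_expansionDeriv hv (by omega) ht)
    fun _ hj => continuousOn_expansionDeriv hv (by omega)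

lemma taylorRemainder_of_expansion {n : ℕ} (hn : n ≤ ⌈α₀⌉₊) :
    EqOn (taylorRemainder T n y)
      (fun t => ∑ j ∈ Finset.Ico n ⌈α₀⌉₊, b j * Phi j t + rlIntegral α₀ v t) (Icc 0 T) := by
  intro t ht
  have h : ∀ k ∈ Finset.range n, iteratedDerivWithin k y (Icc 0 T) 0 / (k.factorial : ℝ) * t ^ k =
      b k * Phi k t := fun k hk => by
    have hk' : k < ⌈α₀⌉₊ := (Finset.mem_range.1 hk).trans_le hn
    rw [iteratedDerivWithin_of_expansion hT hv hy hk' ⟨le_rfl, hT.le⟩,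
      expansionDeriv_apply_zero hk', Phi]
    ring
  rw [taylorRemainder, Finset.sum_congr rfl h, hy ht, expansion,
    ← Finset.sum_range_add_sum_Ico _ hn]
  ring

/-- By the semigroup law the Taylor remainder is $I^\alpha$ of a continuous function, and $D^\alpha$
inverts $I^\alpha$. -/
lemma caputo_of_expansion {α : ℝ} (hα : 0 ≤ α) (hαα₀ : α ≤ α₀) :
    CaputoDifferentiable T α y ∧
      EqOn (caputo T α y) (expansionCaputo α₀ b v α) (Ioc 0 T) := by
  have hn : ⌈α⌉₊ ≤ ⌈α₀⌉₊ := Nat.ceil_mono hαα₀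
  have hpos : ∀ j ∈ Finset.Ico ⌈α⌉₊ ⌈α₀⌉₊, 0 ≤ (j : ℝ) - α := fun j hj =>
    sub_nonneg.2 (Nat.ceil_le.1 (Finset.mem_Ico.1 hj).1)
  have hc : ∀ j ∈ Finset.Ico ⌈α⌉₊ ⌈α₀⌉₊, ContinuousOn
      (fun t => b j * rlIntegral (j - α) (fun _ => 1) t) (Icc 0 T) := fun j hj =>
    continuousOn_const.mul (continuousOn_rlIntegral (hpos j hj) continuousOn_const)
  have hcs : ContinuousOn (fun t => ∑ j ∈ Finset.Ico ⌈α⌉₊ ⌈α₀⌉₊,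
      b j * rlIntegral (j - α) (fun _ => 1) t) (Icc 0 T) := continuousOn_finsetSum _ hc
  have hcv := continuousOn_rlIntegral (sub_nonneg.2 hαα₀) hv
  have hF : ContinuousOn (expansionCaputo α₀ b v α) (Icc 0 T) := hcs.add hcv
  have hw : EqOn (taylorRemainder T ⌈α⌉₊ y) (rlIntegral α (expansionCaputo α₀ b v α))
      (Icc 0 T) := by
    intro t ht
    rw [taylorRemainder_of_expansion hT hv hy hn ht]
    have h1 : rlIntegral α (expansionCaputo α₀ b v α) t = _ := rlIntegral_add hα ht hcs hcv
    rw [h1, rlIntegral_sum hα ht _ hc, rlIntegral_rlIntegral hα (sub_nonneg.2 hαα₀) hv ht,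
      add_sub_cancel]
    refine congrArg (· + _) (Finset.sum_congr rfl fun j hj => ?_)
    rw [rlIntegral_const_mul, rlIntegral_rlIntegral hα (hpos j hj) continuousOn_const ht,
      add_sub_cancel, rlIntegral_natCast_one]
  have h := rlDeriv_of_eqOn_rlIntegral hα hF (hw.mono Ioc_subset_Icc_self)
  refine ⟨⟨fun k hk => ?_, h.1⟩, h.2⟩
  have h0 : (0 : ℝ) ∈ Icc 0 T := ⟨le_rfl, hT.le⟩
  have hk' : k < ⌈α₀⌉₊ := by omega
  exact (hasDerivWithinAt_expansionDeriv hv (by omega) h0).differentiableWithinAt.congr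
    (iteratedDerivWithin_of_expansion hT hv hy hk')
    (iteratedDerivWithin_of_expansion hT hv hy hk' h0)

lemma caputo_top_of_expansion (hα : 0 < α₀) : EqOn (caputo T α₀ y) v (Ioc 0 T) := by
  intro t ht
  rw [(caputo_of_expansion hT hv hy hα.le le_rfl).2 ht]
  simp [expansionCaputo, rlIntegral_zero_order]

lemma memC_of_expansion (hα : 0 < α₀) : MemC T α₀ (⌈α₀⌉₊ - 1) y :=
  ⟨contDiffOn_of_expansion hT hv hy hα, (caputo_of_expansion hT hv hy hα.le le_rfl).1,
    v, hv, caputo_top_of_expansion hT hv hy hα⟩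

end Expansion

/-! ### Every element of $C^{\alpha_0,n_0-1}[0,T]$ has this form -/

lemma eqOn_rlIntegral_one {T : ℝ} {q v : ℝ → ℝ} (hq : ContinuousOn q (Icc 0 T)) (hq0 : q 0 = 0)
    (hv : ContinuousOn v (Icc 0 T)) (hd : ∀ t ∈ Ioo 0 T, HasDerivAt q (v t) t) :
    EqOn q (rlIntegral 1 v) (Icc 0 T) := by
  intro t ht
  have hsub : Icc 0 t ⊆ Icc 0 T := Icc_subset_Icc_right ht.2
  rw [rlIntegral_one, intervalIntegral.integral_eq_sub_of_hasDerivAt_of_le ht.1 (hq.mono hsub)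
    (fun x hx => hd x ⟨hx.1, hx.2.trans_le ht.2⟩), hq0, sub_zero]
  refine ContinuousOn.intervalIntegrable ?_
  rw [uIcc_of_le ht.1]
  exact hv.mono hsub

/-- Taylor's formula with vanishing data, by repeated use of the fundamental theorem of calculus. -/
lemma eqOn_rlIntegral_iteratedDerivWithin {T : ℝ} (hT : 0 < T) {w : ℝ → ℝ} (p : ℕ)
    (hw : ContDiffOn ℝ p w (Icc 0 T))
    (h0 : ∀ k < p, iteratedDerivWithin k w (Icc 0 T) 0 = 0) :
    EqOn w (rlIntegral p (iteratedDerivWithin p w (Icc 0 T))) (Icc 0 T) := by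
  have hU := uniqueDiffOn_Icc hT
  induction p with
  | zero => intro t _; simp [rlIntegral_zero_order, iteratedDerivWithin_zero]
  | succ p ih =>
    have hlt : (p : WithTop ℕ∞) < ((p + 1 : ℕ) : WithTop ℕ∞) := by exact_mod_cast p.lt_succ_self
    have hc := hw.continuousOn_iteratedDerivWithin le_rfl hU
    have hdiff := hw.differentiableOn_iteratedDerivWithin hlt hU
    have hstep : EqOn (iteratedDerivWithin p w (Icc 0 T))
        (rlIntegral 1 (iteratedDerivWithin (p + 1) w (Icc 0 T))) (Icc 0 T) := by
      refine eqOn_rlIntegral_one hdiff.continuousOn (h0 p p.lt_succ_self) hc fun t ht => ?_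
      rw [iteratedDerivWithin_succ]
      exact (hdiff t (Ioo_subset_Icc_self ht)).hasDerivWithinAt.hasDerivAt
        (Icc_mem_nhds ht.1 ht.2)
    intro t ht
    rw [ih (hw.of_le hlt.le) (fun k hk => h0 k (hk.trans p.lt_succ_self)) ht,
      rlIntegral_congr_Icc p.cast_nonneg hstep ht,
      rlIntegral_rlIntegral p.cast_nonneg zero_le_one hc ht]
    push_cast
    rfl

/-- Every `y ∈ C^{α₀, n₀-1}[0, T]` is its Taylor polynomial plus `I^{α₀}` of a continuous
function. -/
theorem exists_expansion_of_memC {T α₀ : ℝ} (hT : 0 < T) (hα : 0 < α₀) {y : ℝ → ℝ}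
    (hy : MemC T α₀ (⌈α₀⌉₊ - 1) y) :
    ∃ v : ℝ → ℝ, ContinuousOn v (Icc 0 T) ∧
      EqOn y (expansion α₀ (fun k => iteratedDerivWithin k y (Icc 0 T) 0) v) (Icc 0 T) := by
  obtain ⟨hcd, ⟨-, hRL⟩, v, hv, hcv⟩ := hy
  refine ⟨v, hv, ?_⟩
  have hU := uniqueDiffOn_Icc hT
  have hI0 : (0 : ℝ) ∈ Icc 0 T := ⟨le_rfl, hT.le⟩
  have hceil := Nat.ceil_pos.2 hα
  obtain ⟨p, hp⟩ : ∃ p, ⌈α₀⌉₊ = p + 1 := ⟨⌈α₀⌉₊ - 1, by omega⟩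
  have hp' : ⌈α₀⌉₊ - 1 = p := by omega
  have hpα : (p : ℝ) < α₀ := Nat.lt_ceil.1 (by omega)
  have hαp : α₀ ≤ p + 1 := by
    have := Nat.le_ceil α₀
    rw [hp] at this
    exact_mod_cast this
  set b : ℕ → ℝ := fun k => iteratedDerivWithin k y (Icc 0 T) 0 with hb
  set w := taylorRemainder T ⌈α₀⌉₊ y with hw
  -- The Taylor polynomial is the case $v=0$, so its derivatives at $0$ are already known.
  set P := expansion α₀ b (fun _ => 0) with hP
  have hPeq : ∀ t, P t = ∑ j ∈ Finset.range ⌈α₀⌉₊, b j * Phi j t := fun t => by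
    simp [hP, expansion, rlIntegral_zero_fun]
  have hwP : w = fun t => y t - P t := by
    ext t
    rw [hw, taylorRemainder, hPeq]
    congr 1
    refine Finset.sum_congr rfl fun k _ => ?_
    rw [Phi, hb]
    ring
  have hc0 : ContinuousOn (fun _ : ℝ => (0 : ℝ)) (Icc 0 T) := continuousOn_const
  have hPcd : ContDiffOn ℝ p P (Icc 0 T) := by
    have := contDiffOn_of_expansion (b := b) hT hc0 (eqOn_refl _ _) hα
    rwa [hp'] at this
  rw [hp'] at hcd
  have hwcd : ContDiffOn ℝ p w (Icc 0 T) := hwP ▸ hcd.sub hPcd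
  have hw0 : ∀ k < p + 1, iteratedDerivWithin k w (Icc 0 T) 0 = 0 := by
    intro k hk
    have hkp : (k : WithTop ℕ∞) ≤ p := by exact_mod_cast Nat.lt_succ_iff.1 hk
    have hk' : k < ⌈α₀⌉₊ := by omega
    have h1 : iteratedDerivWithin k w (Icc 0 T) 0 =
        iteratedDerivWithin k y (Icc 0 T) 0 - iteratedDerivWithin k P (Icc 0 T) 0 := by
      rw [hwP]
      exact iteratedDerivWithin_sub hI0 hU ((hcd.of_le hkp) 0 hI0) ((hPcd.of_le hkp) 0 hI0)
    rw [h1, iteratedDerivWithin_of_expansion hT hc0 (eqOn_refl _ _) hk' hI0,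
      expansionDeriv_apply_zero hk', sub_self]
  set W := iteratedDerivWithin p w (Icc 0 T) with hW
  have hWc : ContinuousOn W (Icc 0 T) := hwcd.continuousOn_iteratedDerivWithin le_rfl hU
  have hwW : EqOn w (rlIntegral p W) (Icc 0 T) :=
    eqOn_rlIntegral_iteratedDerivWithin hT p hwcd fun k hk => hw0 k (by omega)
  set β : ℝ := p + 1 - α₀ with hβ
  have hβ0 : 0 ≤ β := by linarith
  have hβ1 : β < 1 := by linarith
  have hβ' : (⌈α₀⌉₊ : ℝ) - α₀ = β := by rw [hp]; push_cast; rfl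
  -- Since $w=I^pW$, differentiating $I^\beta w=I^{\beta+p}W$ exactly $p$ times leaves $I^\beta W$.
  have hu : EqOn (iteratedDerivWithin p (rlIntegral β w) (Ioc 0 T)) (rlIntegral β W)
      (Ioc 0 T) := by
    have hsub : Ioc 0 T ⊆ Icc 0 T := Ioc_subset_Icc_self
    have h := iteratedDerivWithin_eq_of_chain (uniqueDiffOn_Ioc 0 T) (n := p)
      (y := rlIntegral β w) (F := fun k => rlIntegral (β + p - k) W) (fun t ht => ?_)
      (fun k hk t ht => hasDerivWithinAt_rlIntegral_chain hsub hWc ?_ ht) p le_rfl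
    · simpa using h
    · rw [rlIntegral_congr_Icc hβ0 hwW (hsub ht),
        rlIntegral_rlIntegral hβ0 p.cast_nonneg hWc (hsub ht)]
      simp
    · have : ((k + 1 : ℕ) : ℝ) ≤ p := by exact_mod_cast hk
      linarith
  have hqc := continuousOn_rlIntegral hβ0 hWc
  -- The remaining derivative of $I^\beta W$ is $v$. The value at $0$ vanishes because $\beta>0$ or,
  -- if $\beta=0$, because $W(0)=0$.
  have hq : EqOn (rlIntegral β W) (rlIntegral 1 v) (Icc 0 T) := by
    refine eqOn_rlIntegral_one hqc ?_ hv fun t ht => ?_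
    · rcases hβ0.eq_or_lt with h | h
      · rw [← h, rlIntegral_zero_order]
        exact hw0 p p.lt_succ_self
      · exact rlIntegral_apply_zero h W
    · have ht' : t ∈ Ioc 0 T := Ioo_subset_Ioc_self ht
      have hd := (hRL p (by omega)) t ht'
      rw [hβ'] at hd
      have hval := hcv ht'
      rw [caputo, rlDeriv, hβ', hp, iteratedDerivWithin_succ] at hval
      rw [← hp] at hval
      have hnhds : Ioc 0 T ∈ 𝓝 t := Ioc_mem_nhds ht.1 ht.2
      have hd' := hd.hasDerivWithinAt.hasDerivAt hnhds
      rw [hval] at hd'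
      exact hd'.congr_of_eventuallyEq (hu.symm.eventuallyEq_of_mem hnhds)
  -- Applying $I^{1-\beta}$ to $I^\beta W=I^1v$ raises the left side to $I^1W$; one differentiation
  -- then recovers $W$.
  have h1 : EqOn (rlIntegral 1 W) (rlIntegral (2 - β) v) (Icc 0 T) := by
    intro t ht
    have e1 := rlIntegral_rlIntegral (α := 1 - β) (by linarith) hβ0 hWc ht
    have e2 := rlIntegral_rlIntegral (α := 1 - β) (by linarith) zero_le_one hv ht
    rw [sub_add_cancel] at e1
    rw [← e1, rlIntegral_congr_Icc (by linarith) hq ht, e2]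
    congr 1
    ring
  have h2 : EqOn W (rlIntegral (1 - β) v) (Icc 0 T) := by
    intro t ht
    have d1 := hasDerivWithinAt_rlIntegral le_rfl hWc ht
    have d2 := (hasDerivWithinAt_rlIntegral (γ := 2 - β) (by linarith) hv ht).congr_of_mem h1 ht
    have h := (hU t ht).eq_deriv _ d1 d2
    rw [sub_self, rlIntegral_zero_order] at h
    rw [h]
    congr 1
    ring
  intro t ht
  have e : w t = rlIntegral α₀ v t := by
    rw [hwW ht, rlIntegral_congr_Icc p.cast_nonneg h2 ht,
      rlIntegral_rlIntegral p.cast_nonneg (by linarith) hv ht, hβ]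
    congr 1
    ring
  rw [expansion, ← hPeq, ← e, hwP]
  ring

/-! ### The operator $K$ and its Neumann series -/

lemma abs_rlIntegral_le_Icc {β lam C t : ℝ} (hβ : 0 ≤ β) (hlam : 0 < lam) (ht : 0 ≤ t)
    {f : ℝ → ℝ} (hf : ∀ s ∈ Icc 0 t, |f s| ≤ C * Real.exp (lam * s)) :
    |rlIntegral β f t| ≤ C * (1 / lam) ^ β * Real.exp (lam * t) := by
  rcases ht.eq_or_lt with rfl | ht
  · have h0 := hf 0 ⟨le_rfl, le_rfl⟩
    rcases hβ.eq_or_lt with rfl | hβ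
    · simpa [rlIntegral_zero_order] using h0
    · have hC : 0 ≤ C := by simpa using (abs_nonneg _).trans h0
      rw [rlIntegral_apply_zero hβ, abs_zero]
      positivity
  · exact abs_rlIntegral_le hβ hlam ht fun s hs => hf s (Ioc_subset_Icc_self hs)

lemma tendstoUniformlyOn_of_abs_sub_le {u : ℕ → ℝ → ℝ} {y : ℝ → ℝ} {S : Set ℝ} {C : ℝ}
    (h : ∀ N, ∀ t ∈ S, |u N t - y t| ≤ C * (1 / 2) ^ N) : TendstoUniformlyOn u y atTop S := by
  rw [Metric.tendstoUniformlyOn_iff]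
  intro ε hε
  have hlim : Tendsto (fun N : ℕ => C * (1 / 2 : ℝ) ^ N) atTop (𝓝 0) := by
    simpa using (tendsto_pow_atTop_nhds_zero_of_lt_one (r := (1 / 2 : ℝ)) (by norm_num)
      (by norm_num)).const_mul C
  filter_upwards [hlim.eventually_lt_const hε] with N hN t ht
  rw [dist_comm, Real.dist_eq]
  exact (h N t ht).trans_lt hN

/-- The partial sums `∑_{k < N} (-1)^{k+1} K^k g` of the Neumann series of `-(1 + K)⁻¹ g`. -/
def neumannSum (K : (ℝ → ℝ) → ℝ → ℝ) (g : ℝ → ℝ) (N : ℕ) (t : ℝ) : ℝ :=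
  ∑ k ∈ Finset.range N, (-1 : ℝ) ^ (k + 1) * K^[k] g t

section StepOp

variable {T : ℝ} {m : ℕ} {α : ℕ → ℝ} {a : ℕ → ℝ → ℝ}

/-- The orders $\alpha_0-\alpha_i$ are positive, so the value at $0$ is never seen. This matters
because the fractional derivatives of $\Phi_{j+1}$ are controlled only on $(0,T]$. -/
lemma stepOp_congr (hα : ∀ i ∈ Finset.Icc 1 m, α i < α 0) {f g : ℝ → ℝ}
    (h : EqOn f g (Ioc 0 T)) : EqOn (stepOp m α a f) (stepOp m α a g) (Icc 0 T) := by
  intro t ht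
  refine Finset.sum_congr rfl fun i hi => ?_
  rw [rlIntegral_congr_of_pos (sub_pos.2 (hα i hi)) ht.1
    (h.mono (Ioc_subset_Ioc_right ht.2))]

lemma stepOp_iterate_congr (hα : ∀ i ∈ Finset.Icc 1 m, α i < α 0) {f g : ℝ → ℝ}
    (h : EqOn f g (Ioc 0 T)) (k : ℕ) :
    EqOn ((stepOp m α a)^[k] f) ((stepOp m α a)^[k] g) (Ioc 0 T) := by
  induction k with
  | zero => exact h
  | succ k ih =>
    rw [Function.iterate_succ_apply', Function.iterate_succ_apply']
    exact (stepOp_congr hα ih).mono Ioc_subset_Icc_self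

lemma continuousOn_stepOp (hα : ∀ i ∈ Finset.Icc 1 m, α i < α 0)
    (ha : ∀ i ∈ Finset.Icc 1 m, ContinuousOn (a i) (Icc 0 T)) {f : ℝ → ℝ}
    (hf : ContinuousOn f (Icc 0 T)) : ContinuousOn (stepOp m α a f) (Icc 0 T) :=
  continuousOn_finsetSum _ fun i hi =>
    (ha i hi).mul (continuousOn_rlIntegral (sub_pos.2 (hα i hi)).le hf)

lemma continuousOn_stepOp_iterate (hα : ∀ i ∈ Finset.Icc 1 m, α i < α 0)
    (ha : ∀ i ∈ Finset.Icc 1 m, ContinuousOn (a i) (Icc 0 T)) {f : ℝ → ℝ}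
    (hf : ContinuousOn f (Icc 0 T)) (k : ℕ) :
    ContinuousOn ((stepOp m α a)^[k] f) (Icc 0 T) := by
  induction k with
  | zero => exact hf
  | succ k ih =>
    rw [Function.iterate_succ_apply']
    exact continuousOn_stepOp hα ha ih

lemma continuousOn_neumannSum (hα : ∀ i ∈ Finset.Icc 1 m, α i < α 0)
    (ha : ∀ i ∈ Finset.Icc 1 m, ContinuousOn (a i) (Icc 0 T)) {g : ℝ → ℝ}
    (hg : ContinuousOn g (Icc 0 T)) (N : ℕ) :
    ContinuousOn (neumannSum (stepOp m α a) g N) (Icc 0 T) :=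
  continuousOn_finsetSum _ fun k _ =>
    continuousOn_const.mul (continuousOn_stepOp_iterate hα ha hg k)

lemma stepOp_sub (hα : ∀ i ∈ Finset.Icc 1 m, α i < α 0) {f g : ℝ → ℝ}
    (hf : ContinuousOn f (Icc 0 T)) (hg : ContinuousOn g (Icc 0 T)) {t : ℝ} (ht : t ∈ Icc 0 T) :
    stepOp m α a (fun s => f s - g s) t = stepOp m α a f t - stepOp m α a g t := by
  simp only [stepOp, ← Finset.sum_sub_distrib]
  refine Finset.sum_congr rfl fun i hi => ?_
  rw [rlIntegral_sub (sub_pos.2 (hα i hi)).le ht hf hg, mul_sub]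

lemma stepOp_sum (hα : ∀ i ∈ Finset.Icc 1 m, α i < α 0) {s : Finset ℕ} {c : ℕ → ℝ}
    {f : ℕ → ℝ → ℝ} (hf : ∀ k ∈ s, ContinuousOn (f k) (Icc 0 T)) {t : ℝ} (ht : t ∈ Icc 0 T) :
    stepOp m α a (fun x => ∑ k ∈ s, c k * f k x) t = ∑ k ∈ s, c k * stepOp m α a (f k) t := by
  simp only [stepOp, Finset.mul_sum]
  rw [Finset.sum_comm]
  refine Finset.sum_congr rfl fun i hi => ?_
  rw [rlIntegral_sum (sub_pos.2 (hα i hi)).le ht s (f := fun k x => c k * f k x)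
    fun k hk => continuousOn_const.mul (hf k hk), Finset.mul_sum]
  refine Finset.sum_congr rfl fun k _ => ?_
  rw [rlIntegral_const_mul]
  ring

/-- `stepOp` is a contraction for a sufficiently strong exponential weight. -/
lemma exists_stepOp_contraction (hα : ∀ i ∈ Finset.Icc 1 m, α i < α 0)
    (ha : ∀ i ∈ Finset.Icc 1 m, ContinuousOn (a i) (Icc 0 T)) :
    ∃ lam : ℝ, 0 < lam ∧ ∀ (f : ℝ → ℝ) (C : ℝ),
      (∀ t ∈ Icc 0 T, |f t| ≤ C * Real.exp (lam * t)) →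
      ∀ t ∈ Icc 0 T, |stepOp m α a f t| ≤ C / 2 * Real.exp (lam * t) := by
  have hA : ∀ i, ∃ A, i ∈ Finset.Icc 1 m → ∀ t ∈ Icc 0 T, |a i t| ≤ A := fun i => by
    by_cases hi : i ∈ Finset.Icc 1 m
    · obtain ⟨A, hA⟩ := isCompact_Icc.exists_bound_of_continuousOn (ha i hi)
      exact ⟨A, fun _ => hA⟩
    · exact ⟨0, fun h => absurd h hi⟩
  choose A hA using hA
  -- Each exponent $\alpha_0-\alpha_i$ is positive, so this bound for the weighted norm of the
  -- operator tends to $0$; some $\lambda$ brings it below $1/2$.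
  have hlim : Tendsto (fun lam : ℝ => ∑ i ∈ Finset.Icc 1 m, A i * (1 / lam) ^ (α 0 - α i))
      atTop (𝓝 0) := by
    have h : ∀ i ∈ Finset.Icc 1 m,
        Tendsto (fun lam : ℝ => A i * (1 / lam) ^ (α 0 - α i)) atTop (𝓝 0) := fun i hi => by
      have hpos := sub_pos.2 (hα i hi)
      have h1 : Tendsto (fun lam : ℝ => 1 / lam) atTop (𝓝 0) := by
        simpa using tendsto_inv_atTop_zero (𝕜 := ℝ)
      simpa [Real.zero_rpow hpos.ne'] using (h1.rpow_const (Or.inr hpos.le)).const_mul (A i)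
    simpa using tendsto_finsetSum _ h
  obtain ⟨lam, hlam, hlt⟩ := ((eventually_gt_atTop (0 : ℝ)).and
    (hlim.eventually_lt_const (by norm_num : (0 : ℝ) < 1 / 2))).exists
  refine ⟨lam, hlam, fun f C hf t ht => ?_⟩
  have hC : 0 ≤ C :=
    nonneg_of_mul_nonneg_left ((abs_nonneg _).trans (hf t ht)) (Real.exp_pos _)
  calc |stepOp m α a f t|
      ≤ ∑ i ∈ Finset.Icc 1 m, |a i t * rlIntegral (α 0 - α i) f t| :=
        Finset.abs_sum_le_sum_abs _ _
    _ ≤ ∑ i ∈ Finset.Icc 1 m, A i * (C * (1 / lam) ^ (α 0 - α i) * Real.exp (lam * t)) := by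
        refine Finset.sum_le_sum fun i hi => ?_
        rw [abs_mul]
        refine mul_le_mul (hA i hi t ht) ?_ (abs_nonneg _) ((abs_nonneg _).trans (hA i hi t ht))
        exact abs_rlIntegral_le_Icc (sub_pos.2 (hα i hi)).le hlam ht.1
          fun s hs => hf s ⟨hs.1, hs.2.trans ht.2⟩
    _ = (∑ i ∈ Finset.Icc 1 m, A i * (1 / lam) ^ (α 0 - α i)) * (C * Real.exp (lam * t)) := by
        rw [Finset.sum_mul]
        exact Finset.sum_congr rfl fun i _ => by ring
    _ ≤ 1 / 2 * (C * Real.exp (lam * t)) := by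
        refine mul_le_mul_of_nonneg_right hlt.le ?_
        positivity
    _ = C / 2 * Real.exp (lam * t) := by ring

lemma exists_abs_le_exp {lam : ℝ} (hlam : 0 < lam) {g : ℝ → ℝ} (hg : ContinuousOn g (Icc 0 T)) :
    ∃ C : ℝ, ∀ t ∈ Icc 0 T, |g t| ≤ C * Real.exp (lam * t) := by
  obtain ⟨C, hC⟩ := isCompact_Icc.exists_bound_of_continuousOn hg
  refine ⟨C, fun t ht => (hC t ht).trans ?_⟩
  exact le_mul_of_one_le_right ((norm_nonneg _).trans (hC t ht))
    (Real.one_le_exp (mul_nonneg hlam.le ht.1))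

lemma abs_iterate_le {K : (ℝ → ℝ) → ℝ → ℝ} {lam C : ℝ} {f : ℝ → ℝ}
    (hK : ∀ (f : ℝ → ℝ) (C : ℝ), (∀ t ∈ Icc 0 T, |f t| ≤ C * Real.exp (lam * t)) →
      ∀ t ∈ Icc 0 T, |K f t| ≤ C / 2 * Real.exp (lam * t))
    (hf : ∀ t ∈ Icc 0 T, |f t| ≤ C * Real.exp (lam * t)) (k : ℕ) :
    ∀ t ∈ Icc 0 T, |K^[k] f t| ≤ C / 2 ^ k * Real.exp (lam * t) := by
  induction k with
  | zero => simpa using hf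
  | succ k ih =>
    rw [Function.iterate_succ_apply', pow_succ, ← div_div]
    exact hK _ _ ih

/-- Presents the partial sums as Picard iterates $u_{N+1}=-g-Ku_N$, whose limit is a fixed point. -/
lemma neumannSum_succ (hα : ∀ i ∈ Finset.Icc 1 m, α i < α 0)
    (ha : ∀ i ∈ Finset.Icc 1 m, ContinuousOn (a i) (Icc 0 T)) {g : ℝ → ℝ}
    (hg : ContinuousOn g (Icc 0 T)) (N : ℕ) {t : ℝ} (ht : t ∈ Icc 0 T) :
    neumannSum (stepOp m α a) g (N + 1) t =
      -g t - stepOp m α a (neumannSum (stepOp m α a) g N) t := by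
  have h : stepOp m α a (neumannSum (stepOp m α a) g N) t = _ :=
    stepOp_sum hα (fun k _ => continuousOn_stepOp_iterate hα ha hg k) ht
  rw [h, neumannSum, Finset.sum_range_succ']
  simp only [Function.iterate_succ_apply', Function.iterate_zero, id, pow_succ (-1 : ℝ) (_ + 1),
    mul_neg, mul_one, neg_mul, Finset.sum_neg_distrib, zero_add, pow_one, one_mul]
  ring

/-- The Neumann series converges geometrically to the solution of `v = -g - K v`. -/
theorem exists_neumann_limit (hα : ∀ i ∈ Finset.Icc 1 m, α i < α 0)
    (ha : ∀ i ∈ Finset.Icc 1 m, ContinuousOn (a i) (Icc 0 T)) {g : ℝ → ℝ}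
    (hg : ContinuousOn g (Icc 0 T)) :
    ∃ (v : ℝ → ℝ) (C : ℝ), ContinuousOn v (Icc 0 T) ∧
      (∀ N, ∀ t ∈ Icc 0 T, |neumannSum (stepOp m α a) g N t - v t| ≤ C * (1 / 2) ^ N) ∧
      ∀ t ∈ Icc 0 T, v t = -g t - stepOp m α a v t := by
  obtain ⟨lam, hlam, hK⟩ := exists_stepOp_contraction hα ha
  obtain ⟨C, hC⟩ := exists_abs_le_exp hlam hg
  set u := neumannSum (stepOp m α a) g with hu
  have hstep : ∀ t ∈ Icc 0 T, ∀ N,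
      dist (u N t) (u (N + 1) t) ≤ 2 * (C * Real.exp (lam * t)) / 2 / 2 ^ N := fun t ht N => by
    have h := abs_iterate_le hK hC N t ht
    rw [dist_comm, Real.dist_eq, hu, neumannSum, neumannSum, Finset.sum_range_succ,
      add_sub_cancel_left, abs_mul, abs_pow, abs_neg, abs_one, one_pow, one_mul]
    refine h.trans_eq ?_
    ring
  have hex : ∀ t ∈ Icc 0 T, ∃ l, Tendsto (fun N => u N t) atTop (𝓝 l) := fun t ht =>
    cauchySeq_tendsto_of_complete (cauchySeq_of_le_geometric_two (hstep t ht))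
  choose! v hv using hex
  -- The weight is kept here so that the contraction estimate can be applied again to $u_N-v$.
  have hbound : ∀ N, ∀ t ∈ Icc 0 T,
      |u N t - v t| ≤ 2 * C / 2 ^ N * Real.exp (lam * t) := fun N t ht => by
    have h := dist_le_of_le_geometric_two_of_tendsto (hstep t ht) (hv t ht) N
    rw [Real.dist_eq] at h
    refine h.trans_eq ?_
    ring
  have hC' : ∀ N, ∀ t ∈ Icc 0 T,
      |u N t - v t| ≤ 2 * C * Real.exp (lam * T) * (1 / 2) ^ N := fun N t ht => by
    have hC0 : 0 ≤ C :=
      nonneg_of_mul_nonneg_left ((abs_nonneg _).trans (hC t ht)) (Real.exp_pos _)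
    have hexp : Real.exp (lam * t) ≤ Real.exp (lam * T) :=
      Real.exp_le_exp.2 (mul_le_mul_of_nonneg_left ht.2 hlam.le)
    calc |u N t - v t| ≤ 2 * C / 2 ^ N * Real.exp (lam * t) := hbound N t ht
      _ ≤ 2 * C / 2 ^ N * Real.exp (lam * T) := by gcongr
      _ = 2 * C * Real.exp (lam * T) * (1 / 2) ^ N := by
        rw [one_div, inv_pow]
        ring
  have huc := continuousOn_neumannSum hα ha hg
  have hvc : ContinuousOn v (Icc 0 T) :=
    (tendstoUniformlyOn_of_abs_sub_le hC').continuousOn (Frequently.of_forall huc)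
  refine ⟨v, _, hvc, hC', fun t ht => ?_⟩
  have hlim : Tendsto (fun N => stepOp m α a (u N) t) atTop (𝓝 (stepOp m α a v t)) := by
    rw [tendsto_iff_norm_sub_tendsto_zero]
    have h0 : Tendsto (fun N : ℕ => C * Real.exp (lam * t) * (1 / 2 : ℝ) ^ N) atTop (𝓝 0) := by
      simpa using (tendsto_pow_atTop_nhds_zero_of_lt_one (r := (1 / 2 : ℝ)) (by norm_num)
        (by norm_num)).const_mul (C * Real.exp (lam * t))
    refine squeeze_zero (fun _ => norm_nonneg _) (fun N => ?_) h0
    rw [← stepOp_sub hα (huc N) hvc ht]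
    refine (hK _ _ (hbound N) t ht).trans_eq ?_
    rw [one_div, inv_pow]
    ring
  have h1 : Tendsto (fun N => u (N + 1) t) atTop (𝓝 (-g t - stepOp m α a v t)) := by
    simp only [hu, neumannSum_succ hα ha hg _ ht]
    exact tendsto_const_nhds.sub hlim
  exact tendsto_nhds_unique ((hv t ht).comp (tendsto_add_atTop_nat 1)) h1

/-- The difference $d$ satisfies $d=-Kd$, hence $|d|\le C2^{-N}e^{\lambda t}$ for every $N$. -/
lemma eqOn_of_fixedPoint (hα : ∀ i ∈ Finset.Icc 1 m, α i < α 0)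
    (ha : ∀ i ∈ Finset.Icc 1 m, ContinuousOn (a i) (Icc 0 T)) {g v w : ℝ → ℝ}
    (hv : ContinuousOn v (Icc 0 T)) (hw : ContinuousOn w (Icc 0 T))
    (hv' : ∀ t ∈ Icc 0 T, v t = -g t - stepOp m α a v t)
    (hw' : ∀ t ∈ Icc 0 T, w t = -g t - stepOp m α a w t) : EqOn v w (Icc 0 T) := by
  obtain ⟨lam, hlam, hK⟩ := exists_stepOp_contraction hα ha
  obtain ⟨C, hC⟩ := exists_abs_le_exp hlam (hv.sub hw)
  have hd : ∀ N : ℕ, ∀ t ∈ Icc 0 T, |v t - w t| ≤ C / 2 ^ N * Real.exp (lam * t) := by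
    intro N
    induction N with
    | zero => simpa using hC
    | succ N ih =>
      intro t ht
      have h : v t - w t = -stepOp m α a (fun s => v s - w s) t := by
        rw [stepOp_sub hα hv hw ht, hv' t ht, hw' t ht]
        ring
      rw [h, abs_neg, pow_succ, ← div_div]
      exact hK _ _ ih t ht
  intro t ht
  have h0 : Tendsto (fun N : ℕ => C / 2 ^ N * Real.exp (lam * t)) atTop (𝓝 0) := by
    have := (tendsto_pow_atTop_nhds_zero_of_lt_one (r := (1 / 2 : ℝ)) (by norm_num)
      (by norm_num)).const_mul (C * Real.exp (lam * t))
    rw [mul_zero] at this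
    refine this.congr fun N => ?_
    rw [one_div, inv_pow]
    ring
  have h := ge_of_tendsto' h0 fun N => hd N t ht
  exact sub_eq_zero.1 (abs_nonpos_iff.1 h)

end StepOp

/-! ### Equivalence of the initial value problem with the integral equation -/

/-- The function `∑_{i : α_i ≤ j} a_i Φ_{j+1-α_i}`, continuous on `[0, T]`. -/
def phiSource (m : ℕ) (α : ℕ → ℝ) (a : ℕ → ℝ → ℝ) (j : ℕ) (t : ℝ) : ℝ :=
  ∑ i ∈ Finset.Icc 1 m, a i t *
    if α i ≤ j then rlIntegral (j - α i) (fun _ => 1) t else 0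

section Equation

variable {T : ℝ} {m : ℕ} {α : ℕ → ℝ} {a : ℕ → ℝ → ℝ}

lemma continuousOn_phiSource (ha : ∀ i ∈ Finset.Icc 1 m, ContinuousOn (a i) (Icc 0 T)) (j : ℕ) :
    ContinuousOn (phiSource m α a j) (Icc 0 T) := by
  refine continuousOn_finsetSum _ fun i hi => (ha i hi).mul ?_
  by_cases h : α i ≤ j
  · simpa only [if_pos h] using continuousOn_rlIntegral (sub_nonneg.2 h) continuousOn_const
  · simpa only [if_neg h] using continuousOn_const

/-- Interchange of the two sums: since $\lceil\alpha_i\rceil\le j$ means $\alpha_i\le j$, the terms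
surviving the $\alpha_i$-th derivative are those counted in the source. -/
lemma sum_mul_expansionCaputo (b : ℕ → ℝ) (v : ℝ → ℝ) (t : ℝ) :
    ∑ i ∈ Finset.Icc 1 m, a i t * expansionCaputo (α 0) b v (α i) t =
      ∑ j ∈ Finset.range ⌈α 0⌉₊, b j * phiSource m α a j t + stepOp m α a v t := by
  have h : ∀ i, expansionCaputo (α 0) b v (α i) t =
      ∑ j ∈ Finset.range ⌈α 0⌉₊, b j * (if α i ≤ j then
        rlIntegral (j - α i) (fun _ => 1) t else 0) + rlIntegral (α 0 - α i) v t := fun i => by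
    have hset : Finset.Ico ⌈α i⌉₊ ⌈α 0⌉₊ =
        (Finset.range ⌈α 0⌉₊).filter fun j : ℕ => α i ≤ j := by
      ext j
      simp [Nat.ceil_le, and_comm]
    simp only [expansionCaputo, hset, Finset.sum_filter, mul_ite, mul_zero]
  simp only [h, mul_add, Finset.sum_add_distrib, stepOp, phiSource, Finset.mul_sum]
  rw [Finset.sum_comm]
  simp only [mul_left_comm]

lemma isSolution_of_expansion (hT : 0 < T) (h0 : 0 < α 0)
    (hα0 : ∀ i ∈ Finset.Icc 1 m, 0 ≤ α i) (hα : ∀ i ∈ Finset.Icc 1 m, α i < α 0)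
    {b : ℕ → ℝ} {v y : ℝ → ℝ}
    (hv : ContinuousOn v (Icc 0 T)) (hy : EqOn y (expansion (α 0) b v) (Icc 0 T))
    (heq : ∀ t ∈ Icc 0 T, v t = -(∑ j ∈ Finset.range ⌈α 0⌉₊, b j * phiSource m α a j t) -
      stepOp m α a v t) :
    IsSolution T m α a b y where
  mem := memC_of_expansion hT hv hy h0
  exists_deriv i hi := (caputo_of_expansion hT hv hy (hα0 i hi) (hα i hi).le).1
  equation t ht := by
    have ht' : t ∈ Ioc 0 T := Ioo_subset_Ioc_self ht
    have h : ∀ i ∈ Finset.Icc 1 m, a i t * caputo T (α i) y t =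
        a i t * expansionCaputo (α 0) b v (α i) t := fun i hi => by
      rw [(caputo_of_expansion hT hv hy (hα0 i hi) (hα i hi).le).2 ht']
    rw [caputo_top_of_expansion hT hv hy h0 ht', Finset.sum_congr rfl h,
      sum_mul_expansionCaputo, heq t (Ioo_subset_Icc_self ht)]
    ring
  initial k hk := by
    have hI : (0 : ℝ) ∈ Icc 0 T := ⟨le_rfl, hT.le⟩
    have hD := iteratedDerivWithin_of_expansion hT hv hy hk
    have hc := (continuousOn_expansionDeriv (b := b) hv hk).congr hD 0 hI
    rw [ContinuousWithinAt, hD hI, expansionDeriv_apply_zero hk] at hc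
    exact hc.mono_left (nhdsWithin_le_iff.2 (Icc_mem_nhdsGT hT))

lemma exists_expansion_of_isSolution (hT : 0 < T) (h0 : 0 < α 0)
    (hα0 : ∀ i ∈ Finset.Icc 1 m, 0 ≤ α i) (hα : ∀ i ∈ Finset.Icc 1 m, α i < α 0)
    (ha : ∀ i ∈ Finset.Icc 1 m, ContinuousOn (a i) (Icc 0 T))
    {b : ℕ → ℝ} {y : ℝ → ℝ} (hy : IsSolution T m α a b y) :
    ∃ v : ℝ → ℝ, ContinuousOn v (Icc 0 T) ∧ EqOn y (expansion (α 0) b v) (Icc 0 T) ∧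
      ∀ t ∈ Icc 0 T, v t = -(∑ j ∈ Finset.range ⌈α 0⌉₊, b j * phiSource m α a j t) -
        stepOp m α a v t := by
  obtain ⟨v, hv, hyv⟩ := exists_expansion_of_memC hT h0 hy.mem
  have hI : (0 : ℝ) ∈ Icc 0 T := ⟨le_rfl, hT.le⟩
  -- The derivatives up to order $n_0-1$ are continuous at $0$, so the prescribed limits at $0+$ are
  -- their values there.
  have hb : ∀ k < ⌈α 0⌉₊, iteratedDerivWithin k y (Icc 0 T) 0 = b k := fun k hk => by
    have hkn : (k : WithTop ℕ∞) ≤ (⌈α 0⌉₊ - 1 : ℕ) := by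
      exact_mod_cast Nat.le_sub_one_of_lt hk
    have hc := hy.mem.1.continuousOn_iteratedDerivWithin hkn (uniqueDiffOn_Icc hT) 0 hI
    exact tendsto_nhds_unique (hc.mono_left (nhdsWithin_le_iff.2 (Icc_mem_nhdsGT hT)))
      (hy.initial k hk)
  have hyb : EqOn y (expansion (α 0) b v) (Icc 0 T) := fun t ht => by
    rw [hyv ht, expansion, expansion]
    refine congrArg (· + _) (Finset.sum_congr rfl fun j hj => ?_)
    rw [hb j (Finset.mem_range.1 hj)]
  refine ⟨v, hv, hyb, ?_⟩
  have hR : ContinuousOn (fun t => -(∑ j ∈ Finset.range ⌈α 0⌉₊, b j * phiSource m α a j t) -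
      stepOp m α a v t) (Icc 0 T) :=
    (continuousOn_finsetSum _ fun j _ =>
      continuousOn_const.mul (continuousOn_phiSource ha j)).neg.sub (continuousOn_stepOp hα ha hv)
  have hIoo : EqOn v (fun t => -(∑ j ∈ Finset.range ⌈α 0⌉₊, b j * phiSource m α a j t) -
      stepOp m α a v t) (Ioo 0 T) := fun t ht => by
    have ht' : t ∈ Ioc 0 T := Ioo_subset_Ioc_self ht
    have h : ∀ i ∈ Finset.Icc 1 m, a i t * caputo T (α i) y t =
        a i t * expansionCaputo (α 0) b v (α i) t := fun i hi => by
      rw [(caputo_of_expansion hT hv hyb (hα0 i hi) (hα i hi).le).2 ht']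
    have heq := hy.equation t ht
    rw [caputo_top_of_expansion hT hv hyb h0 ht', Finset.sum_congr rfl h,
      sum_mul_expansionCaputo] at heq
    rw [heq]
    ring
  -- The equation is given on $(0,T)$ only; both sides are continuous, so it extends to the closed
  -- interval.
  exact hIoo.of_subset_closure hv hR Ioo_subset_Icc_self (closure_Ioo hT.ne).symm.subset

lemma sum_single_mul {n j : ℕ} (hj : j < n) (f : ℕ → ℝ) :
    ∑ k ∈ Finset.range n, (if k = j then 1 else 0) * f k = f j := by
  simp [hj]

/-- If `{i : α_i ≤ j} = {l, …, m}`, the functions `partialSum` are the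
expansions with the partial sums of the Neumann series. -/
lemma partialSum_eq_expansion (h0 : 0 < α 0)
    (hα0 : ∀ i ∈ Finset.Icc 1 m, 0 ≤ α i) (hα : ∀ i ∈ Finset.Icc 1 m, α i < α 0)
    (ha : ∀ i ∈ Finset.Icc 1 m, ContinuousOn (a i) (Icc 0 T)) {j l : ℕ} (hj : j < ⌈α 0⌉₊)
    (hl : ∀ i, i ∈ Finset.Icc l m ↔ i ∈ Finset.Icc 1 m ∧ α i ≤ j) (N : ℕ) :
    EqOn (partialSum T m α a j l N) (expansion (α 0) (fun k => if k = j then 1 else 0)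
      (neumannSum (stepOp m α a) (phiSource m α a j) N)) (Icc 0 T) := by
  intro t ht
  have hsrc : EqOn (fun s => ∑ i ∈ Finset.Icc l m, a i s * PhiFrac T j (α i) s)
      (phiSource m α a j) (Ioc 0 T) := fun s hs => by
    have hset : Finset.Icc l m = (Finset.Icc 1 m).filter fun i => α i ≤ j := by
      ext i
      rw [hl, Finset.mem_filter]
    simp only [phiSource, mul_ite, mul_zero]
    rw [← Finset.sum_filter, hset]
    refine Finset.sum_congr rfl fun i hi => ?_
    obtain ⟨hi, hij⟩ := Finset.mem_filter.1 hi
    rw [phiFrac_eq (hα0 i hi) hij hs]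
  have hsum : rlIntegral (α 0) (neumannSum (stepOp m α a) (phiSource m α a j) N) t =
      ∑ k ∈ Finset.range N, rlIntegral (α 0)
        (fun s => (-1 : ℝ) ^ (k + 1) * (stepOp m α a)^[k] (phiSource m α a j) s) t :=
    rlIntegral_sum h0.le ht _ fun k _ => continuousOn_const.mul
      (continuousOn_stepOp_iterate hα ha (continuousOn_phiSource ha j) k)
  rw [expansion, sum_single_mul hj (fun k => Phi k t), hsum, partialSum]
  refine congrArg (_ + ·) (Finset.sum_congr rfl fun k _ => ?_)
  rw [rlIntegral_const_mul, rlIntegral_congr_of_pos h0 ht.1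
    ((stepOp_iterate_congr hα hsrc k).mono (Ioc_subset_Ioc_right ht.2))]

/-- Geometric uniform convergence `w N → v` in `C[0, T]` gives convergence of the expansions in
`C^{α₀, n₀-1}[0, T]`. -/
lemma tendstoC_of_expansion {α₀ C : ℝ} (hT : 0 < T) (h0 : 0 < α₀) {b : ℕ → ℝ}
    {w u : ℕ → ℝ → ℝ} {v y : ℝ → ℝ} (hw : ∀ N, ContinuousOn (w N) (Icc 0 T))
    (hv : ContinuousOn v (Icc 0 T))
    (hwv : ∀ N, ∀ t ∈ Icc 0 T, |w N t - v t| ≤ C * (1 / 2) ^ N)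
    (hu : ∀ N, EqOn (u N) (expansion α₀ b (w N)) (Icc 0 T))
    (hy : EqOn y (expansion α₀ b v) (Icc 0 T)) : TendstoC T α₀ (⌈α₀⌉₊ - 1) u y := by
  have hpos := Nat.ceil_pos.2 h0
  refine ⟨fun N => memC_of_expansion hT (hw N) (hu N) h0, memC_of_expansion hT hv hy h0,
    fun k hk => ?_, ?_⟩
  · have hk' : k < ⌈α₀⌉₊ := by omega
    have hkα : 0 ≤ α₀ - k := (sub_pos.2 (Nat.lt_ceil.1 hk')).le
    refine tendstoUniformlyOn_of_abs_sub_le (C := C * Real.exp T) fun N t ht => ?_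
    rw [iteratedDerivWithin_of_expansion hT (hw N) (hu N) hk' ht,
      iteratedDerivWithin_of_expansion hT hv hy hk' ht, expansionDeriv, expansionDeriv,
      add_sub_add_left_eq_sub, ← rlIntegral_sub hkα ht (hw N) hv]
    -- With $\lambda=1$ the factor $\lambda^{-(\alpha_0-k)}$ is $1$; the weight costs only $e^T$.
    have h := abs_rlIntegral_le_Icc (lam := 1) (C := C * (1 / 2) ^ N) hkα one_pos ht.1
      (f := fun s => w N s - v s) fun s hs => by
        have hs' := hwv N s ⟨hs.1, hs.2.trans ht.2⟩
        refine hs'.trans (le_mul_of_one_le_right ((abs_nonneg _).trans hs') ?_)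
        exact Real.one_le_exp (by simpa using hs.1)
    have hC := (abs_nonneg _).trans (hwv N t ht)
    calc _ ≤ _ := h
      _ = C * (1 / 2) ^ N * Real.exp t := by simp
      _ ≤ C * (1 / 2) ^ N * Real.exp T :=
        mul_le_mul_of_nonneg_left (Real.exp_le_exp.2 ht.2) hC
      _ = C * Real.exp T * (1 / 2) ^ N := by ring
  · refine tendstoUniformlyOn_of_abs_sub_le (C := C) fun N t ht => ?_
    rw [caputo_top_of_expansion hT (hw N) (hu N) h0 ht, caputo_top_of_expansion hT hv hy h0 ht]
    exact hwv N t (Ioc_subset_Icc_self ht)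

/-- Superposition of expansions. -/
lemma sum_mul_expansion_single {α₀ : ℝ} (h0 : 0 < α₀) {b : ℕ → ℝ} {v : ℕ → ℝ → ℝ}
    (hv : ∀ j, ContinuousOn (v j) (Icc 0 T)) :
    EqOn (fun t => ∑ j ∈ Finset.range ⌈α₀⌉₊,
        b j * expansion α₀ (fun k => if k = j then 1 else 0) (v j) t)
      (expansion α₀ b fun t => ∑ j ∈ Finset.range ⌈α₀⌉₊, b j * v j t) (Icc 0 T) := by
  intro t ht
  rw [expansion, rlIntegral_sum h0.le ht _ (f := fun j t => b j * v j t)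
    fun j _ => continuousOn_const.mul (hv j), ← Finset.sum_add_distrib]
  refine Finset.sum_congr rfl fun j hj => ?_
  rw [expansion, sum_single_mul (Finset.mem_range.1 hj) (fun k => Phi k t), rlIntegral_const_mul,
    mul_add]

end Equation

end FracODE

end

/-! ### The canonical fundamental system -/

open FracODE in
theorem corollary4 (T : ℝ) (hT : 0 < T) (m : ℕ) (α : ℕ → ℝ) (a : ℕ → ℝ → ℝ)
    (hα_nonneg : ∀ i ≤ m, 0 ≤ α i)
    (hα_anti : ∀ i < m, α (i + 1) < α i)
    (ha : ∀ i ∈ Finset.Icc 1 m, ContinuousOn (a i) (Set.Icc 0 T))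
    (hn : ⌈α 1⌉₊ < ⌈α 0⌉₊)
    (j₀ : ℕ) (hj₀ : j₀ + 2 ≤ ⌈α 0⌉₊)
    (hH_empty : FracODE.indexSet m α j₀ = ∅)
    (hH_nonempty : (FracODE.indexSet m α (j₀ + 1)).Nonempty) :
    ∃ y : ℕ → ℝ → ℝ,
      FracODE.IsCanonicalSystem T m α a y ∧
      (∀ j ≤ j₀, Set.EqOn (y j) (FracODE.Phi j) (Set.Icc 0 T)) ∧
      (∀ j, j₀ + 1 ≤ j → j < ⌈α 1⌉₊ →
        FracODE.TendstoC T (α 0) (⌈α 0⌉₊ - 1)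
          (FracODE.partialSum T m α a j (FracODE.minIndex m α j)) (y j)) ∧
      (∀ j, ⌈α 1⌉₊ ≤ j → j < ⌈α 0⌉₊ →
        FracODE.TendstoC T (α 0) (⌈α 0⌉₊ - 1)
          (FracODE.partialSum T m α a j 1) (y j)) ∧
      ∀ b : ℕ → ℝ,
        FracODE.IsSolution T m α a b
          (fun t => ∑ j ∈ Finset.range ⌈α 0⌉₊, b j * y j t) ∧
        ∀ z : ℝ → ℝ, FracODE.IsSolution T m α a b z →
          Set.EqOn z (fun t => ∑ j ∈ Finset.range ⌈α 0⌉₊, b j * y j t) (Set.Icc 0 T) := by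
  have h0 : 0 < α 0 := Nat.ceil_pos.1 (by omega)
  have hanti : ∀ i k, i ≤ k → k ≤ m → α k ≤ α i := by
    intro i k hik
    induction k, hik using Nat.le_induction with
    | base => exact fun _ => le_rfl
    | succ k hk ih => exact fun hkm => (hα_anti k hkm).le.trans (ih (by omega))
  have hα0 : ∀ i ∈ Finset.Icc 1 m, 0 ≤ α i := fun i hi => hα_nonneg i (Finset.mem_Icc.1 hi).2
  have hα : ∀ i ∈ Finset.Icc 1 m, α i < α 0 := fun i hi => by
    obtain ⟨h1, h2⟩ := Finset.mem_Icc.1 hi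
    exact (hanti 1 i h1 h2).trans_lt (hα_anti 0 (by omega))
  choose v C hv hC hfix using fun j : ℕ =>
    exists_neumann_limit hα ha (continuousOn_phiSource (α := α) ha j)
  let δ : ℕ → ℕ → ℝ := fun j k => if k = j then 1 else 0
  let y : ℕ → ℝ → ℝ := fun j => expansion (α 0) (δ j) (v j)
  have hconv : ∀ j l, j < ⌈α 0⌉₊ →
      (∀ i, i ∈ Finset.Icc l m ↔ i ∈ Finset.Icc 1 m ∧ α i ≤ j) →
      TendstoC T (α 0) (⌈α 0⌉₊ - 1) (partialSum T m α a j l) (y j) := fun j l hj hl =>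
    tendstoC_of_expansion hT h0 (continuousOn_neumannSum hα ha (continuousOn_phiSource ha j))
      (hv j) (hC j) (partialSum_eq_expansion h0 hα0 hα ha hj hl) (Set.eqOn_refl _ _)
  refine ⟨y, ?_, ?_, ?_, ?_, ?_⟩
  · intro j hj
    refine isSolution_of_expansion hT h0 hα0 hα (hv j) (Set.eqOn_refl _ _) fun t ht => ?_
    rw [sum_single_mul hj (fun k => phiSource m α a k t)]
    exact hfix j t ht
  · intro j hj t ht
    -- Since $H_{j_0}$ is empty, no $\alpha_i$ is at most $j\le j_0$, so the source vanishes and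
    -- uniqueness forces $v_j=0$.
    have hsrc : ∀ s, phiSource m α a j s = 0 := fun s => by
      refine Finset.sum_eq_zero fun i hi => ?_
      obtain ⟨h1, h2⟩ := Finset.mem_Icc.1 hi
      rw [if_neg, mul_zero]
      intro hij
      have : i ∈ indexSet m α j₀ :=
        ⟨h1, h2, hα_nonneg i h2, hij.trans (Nat.cast_le.2 hj)⟩
      rw [hH_empty] at this
      exact this
    have hvz : Set.EqOn (v j) (fun _ => 0) (Set.Icc 0 T) :=
      eqOn_of_fixedPoint hα ha (hv j) continuousOn_const (hfix j) fun s _ => by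
        simp [hsrc, stepOp, rlIntegral_zero_fun]
    have e := rlIntegral_congr_Icc h0.le hvz ht
    change expansion (α 0) (δ j) (v j) t = Phi j t
    rw [expansion, e, rlIntegral_zero_fun, add_zero]
    exact sum_single_mul (by omega) (fun k => Phi k t)
  · intro j hj hj1
    have hne : (indexSet m α j).Nonempty := by
      obtain ⟨i, h1, h2, h3, h4⟩ := hH_nonempty
      exact ⟨i, h1, h2, h3, h4.trans (by exact_mod_cast hj)⟩
    have hmem : minIndex m α j ∈ indexSet m α j := Nat.sInf_mem hne
    -- As the $\alpha_i$ decrease, $\{i:\alpha_i\le j\}$ is the final segment starting at its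
    -- minimum $h_j$.
    refine hconv j _ (hj1.trans hn) fun i => ?_
    rw [Finset.mem_Icc, Finset.mem_Icc]
    constructor
    · rintro ⟨h1, h2⟩
      exact ⟨⟨hmem.1.trans h1, h2⟩, (hanti _ i h1 h2).trans hmem.2.2.2⟩
    · rintro ⟨⟨h1, h2⟩, h3⟩
      exact ⟨Nat.sInf_le ⟨h1, h2, hα_nonneg i h2, h3⟩, h2⟩
  · intro j hj1 hj
    -- Here $\alpha_i\le\alpha_1\le n_1\le j$, so every index contributes.
    refine hconv j 1 hj fun i => ⟨fun hi => ⟨hi, ?_⟩, fun hi => hi.1⟩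
    obtain ⟨h1, h2⟩ := Finset.mem_Icc.1 hi
    exact (hanti 1 i h1 h2).trans (Nat.ceil_le.1 hj1)
  · intro b
    set V : ℝ → ℝ := fun t => ∑ j ∈ Finset.range ⌈α 0⌉₊, b j * v j t with hV
    have hVc : ContinuousOn V (Set.Icc 0 T) :=
      continuousOn_finsetSum _ fun j _ => continuousOn_const.mul (hv j)
    -- The integral equation is linear, so superposing the $v_j$ solves it with source $\sum_j
    -- b_jg_j$.
    have hVeq : ∀ t ∈ Set.Icc 0 T, V t =
        -(∑ j ∈ Finset.range ⌈α 0⌉₊, b j * phiSource m α a j t) - stepOp m α a V t := by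
      intro t ht
      rw [hV, stepOp_sum hα (fun j _ => hv j) ht, ← Finset.sum_neg_distrib,
        ← Finset.sum_sub_distrib]
      refine Finset.sum_congr rfl fun j _ => ?_
      rw [hfix j t ht]
      ring
    have hY := sum_mul_expansion_single (b := b) h0 hv
    refine ⟨isSolution_of_expansion hT h0 hα0 hα hVc hY hVeq, fun z hz t ht => ?_⟩
    obtain ⟨w, hw, hzw, hweq⟩ := exists_expansion_of_isSolution hT h0 hα0 hα ha hz
    have hwV : Set.EqOn w V (Set.Icc 0 T) :=
      eqOn_of_fixedPoint (g := fun t => ∑ j ∈ Finset.range ⌈α 0⌉₊, b j * phiSource m α a j t)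
        hα ha hw hVc hweq hVeq
    rw [hzw ht]
    refine Eq.trans ?_ (hY ht).symm
    rw [expansion, expansion, rlIntegral_congr_Icc h0.le hwV ht]
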